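/- Let $a\ge 2$ be an integer. Let $V_j=(V_j(t))_{t\ge 0}$, $j\in\mathbb Z$, be independent continuous-time simple symmetric random walks on $\mathbb Z$ with $V_j(0)=aj$ (compound Poisson processes with $\mathrm E[e^{iz(V_j(t)-V_j(s))}]=e^{(t-s)(\cos z-1)}$ for $0\le s\le t$), and write $\mathrm E$ for their expectation. For $n\in\mathbb N_0$ let $I_n(z)=(z/2)^n\sum_{\ell\ge 0}\frac{(z/2)^{2\ell}}{\ell!\,\Gamma(n+\ell+1)}$ be the modified Bessel function. For $k\in\mathbb Z$ let $$\widehat\Phi^{k}(z)=\prod_{j\ne k}\frac{z-aj}{ak-aj}=\frac{\sin(\pi(z/a-k))}{\pi(z/a-k)},\qquad \widehat{\mathcal M}^{k}(t,y)=e^{t}\sum_{w\in\mathbb Z}I_{|w-y|}(-t)\,\widehat\Phi^{k}(w),\quad (t,y)\in[0,\infty)\times\mathbb Z,$$ and for finite $J\subset\mathbb Z$ let $\widehat{\mathcal D}_J(T)=\det_{j,k\in J}[\widehat{\mathcal M}^{k}(T,V_j(T))]$. A process $\Xi(t)$, $t\ge 0$, of nonnegative integer-valued Radon measures on $\mathbb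 Z$ is called a noncolliding random walk started at $\xi_{a\mathbb Z}=\sum_{k\in\mathbb Z}\delta_{ak}$ if it has the determinantal martingale representation: for all $0\le t_1<\dots<t_M\le T$ and every bounded functional $F$ of $M$ configurations that depends only on their restrictions to a finite set of sites, $$\mathbb E[F(\Xi(t_1),\dots,\Xi(t_M))]=\lim_{J\uparrow\mathbb Z}\mathrm E\Big[F\Big(\sum_{j\in J}\delta_{V_j(t_1)},\dots,\sum_{j\in J}\delta_{V_j(t_M)}\Big)\,\widehat{\mathcal D}_J(T)\Big],$$ the limit being along the finite subsets $J$ of $\mathbb Z$ ordered by inclusion. Put, for $(s,x),(t,y)\in[0,\infty)\times\mathbb Z$, $$\mathbb K(s,x;t,y)=\sum_{j\in\mathbb Z}I_{|x-aj|}(s)\,\frac1{2\pi}\int_{-\pi}^{\pi}e^{i\lambda(y/a-j)-t\cos(\lambda/a)}\,d\lambda-\mathbf 1(s>t)\,I_{|x-y|}(s-t).$$ Then every noncolliding random walk $\Xi$ started at $\xi_{a\mathbb Z}$ is determinantal with correlation kernel $\mathbb K$: for all $0\le t_1<\dots<t_M$ and all finitely supported $f_1,\dots,f_M:\mathbb Z\to\mathbb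 R$, with $\chi_m=e^{f_m}-1$, the moment generating function is finite and $$\mathbb E\Big[\exp\Big\{\sum_{m=1}^M\int f_m\,d\Xi(t_m)\Big\}\Big]=\sum_{A_1,\dots,A_M}\ \prod_{m=1}^M\prod_{x\in A_m}\chi_m(x)\ \det\big[\mathbb K(t_m,x;t_n,y)\big]_{(m,x),(n,y)},$$ where the sum is over all $M$-tuples of finite subsets of $\mathbb Z$ and the rows and columns of the determinant are indexed by the pairs $(m,x)$ with $1\le m\le M$, $x\in A_m$ (so all spatio-temporal correlation functions are these determinants). Moreover, without reference to any process $\Xi$, for all such $t_m$, $f_m$ and every $T\ge t_M$ the limit on the right-hand side of the representation exists for $F(\eta_1,\dots,\eta_M)=\exp\{\sum_m\int f_m\,d\eta_m\}$ and is equal to the same Fredholm expansion. -/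

import Mathlib

open MeasureTheory ProbabilityTheory Filter Topology
open scoped NNReal

namespace NoncollidingRW

noncomputable section

/-- Modified Bessel function of the first kind `I_n` of integer order `n ≥ 0`, at a real argument:
`I_n(z) = (z/2)^n ∑_{l ≥ 0} (z/2)^{2l} / (l! Γ(n+l+1))`. -/
def besselI (n : ℕ) (z : ℝ) : ℝ :=
  (z / 2) ^ n * ∑' l : ℕ, (z / 2) ^ (2 * l) / ((l.factorial : ℝ) * Real.Gamma ((n : ℝ) + l + 1))

/-- The continuous-time simple symmetric random walk on `ℤ` started at `x`: the compound Poisson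
process with rate one and jump law `(δ₋₁ + δ₁)/2`, i.e. the càdlàg process with independent
increments such that `V(t) - V(s)` has characteristic function `exp((t-s)(cos z - 1))`. -/
structure IsRandomWalk {Ω : Type*} [MeasurableSpace Ω] (P : Measure Ω)
    (V : ℝ≥0 → Ω → ℤ) (x : ℤ) : Prop where
  measurable : ∀ t, Measurable (V t)
  initial : ∀ᵐ ω ∂P, V 0 ω = x
  indepIncrements : HasIndepIncrements V P
  charFun_increment : ∀ s t : ℝ≥0, s ≤ t → ∀ z : ℝ,
    ∫ ω, Complex.exp (Complex.I * z * ((V t ω - V s ω : ℤ) : ℂ)) ∂P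
      = Complex.exp (((t : ℂ) - s) * (Complex.cos z - 1))
  cadlag : ∀ᵐ ω ∂P, ∀ t : ℝ≥0,
    ContinuousWithinAt (fun s => V s ω) (Set.Ici t) t ∧
      ∃ l : ℤ, Tendsto (fun s => V s ω) (𝓝[<] t) (𝓝 l)

/-- A nonnegative integer-valued Radon measure `η` on the discrete space `ℤ`, given by its values
`η x = η({x})`. -/
abbrev Config : Type := ℤ → ℕ

/-- The configuration `∑_{j ∈ J} δ_{v j}`. -/
def empirical (J : Finset ℤ) (v : ℤ → ℤ) : Config :=
  fun x => (J.filter (fun j => v j = x)).card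

/-- The transformation `𝒮[f(W) | (t, x)] = e^t ∑_{w ∈ ℤ} I_{|w-x|}(-t) f(w)`. -/
def transformS (f : ℤ → ℝ) (t : ℝ≥0) (x : ℤ) : ℝ :=
  Real.exp t * ∑' w : ℤ, besselI (w - x).natAbs (-(t : ℝ)) * f w

/-- The entire function `∏_{j ≠ k} (z - a j) / (a k - a j) = sin(π(z/a - k)) / (π(z/a - k))`,
with value `1` at `z = a k`, on the real line. -/
def hatPhi (a : ℕ) (k : ℤ) (z : ℝ) : ℝ :=
  Real.sinc (Real.pi * (z / a - k))

/-- `M^k(t, y) = 𝒮[Φ^k(W) | (t, y)]`. -/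
def hatM (a : ℕ) (k : ℤ) (t : ℝ≥0) (y : ℤ) : ℝ :=
  transformS (fun w => hatPhi a k w) t y

/-- `det_{j,k ∈ J} [M^k(t, v j)]`. -/
def hatD (a : ℕ) (J : Finset ℤ) (t : ℝ≥0) (v : ℤ → ℤ) : ℝ :=
  Matrix.det (Matrix.of fun j k : J => hatM a k t (v j))

/-- The expectation `E[F(∑_{j ∈ J} δ_{V_j(·)}) det_{j,k ∈ J} [M^k(T, V_j(T))]]` of the determinantal
martingale representation over the finitely many walks with labels in `J`, for a functional `F`
of the configurations at the times `t 0, t 1, …`. -/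
def dmrExpectation {Ω : Type*} [MeasurableSpace Ω] (P : Measure Ω) (V : ℤ → ℝ≥0 → Ω → ℤ) (a : ℕ)
    {M : ℕ} (t : Fin M → ℝ≥0) (T : ℝ≥0) (F : (Fin M → Config) → ℝ) (J : Finset ℤ) : ℝ :=
  ∫ ω, F (fun m => empirical J (fun j => V j (t m) ω)) * hatD a J T (fun j => V j T ω) ∂P

/-- `F` depends only on the configurations inside some finite window of sites (so that, on
configurations without multiple points, it depends on boundedly many particles). -/
def IsLocal {M : ℕ} (F : (Fin M → Config) → ℝ) : Prop :=
  ∃ W : Finset ℤ, ∀ η η' : Fin M → Config, (∀ m, ∀ x ∈ W, η m x = η' m x) → F η = F η'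

/-- `(Ξ, P)` is the noncolliding random walk started at `∑_k δ_{ak}`: its law is given by the
determinantal martingale representation in terms of the walks `V_j` (with `V_j(0) = a j`) under
`P'`. The expectation of every bounded local functional at times up to `T` is the limit, as the
finite label set `J` increases to `ℤ`, of the representation over the walks labelled by `J`. -/
structure IsNoncollidingRW {Ω' : Type*} [MeasurableSpace Ω'] (P' : Measure Ω')
    (V : ℤ → ℝ≥0 → Ω' → ℤ) (a : ℕ) {Ω : Type*} [MeasurableSpace Ω] (P : Measure Ω)
    (Ξ : ℝ≥0 → Ω → Config) : Prop where
  measurable : ∀ t, Measurable (Ξ t)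
  representation : ∀ (M : ℕ) (t : Fin M → ℝ≥0) (T : ℝ≥0), StrictMono t → (∀ m, t m ≤ T) →
    ∀ F : (Fin M → Config) → ℝ, IsLocal F → (∃ C : ℝ, ∀ η, |F η| ≤ C) →
      Tendsto (dmrExpectation P' V a t T F) atTop (𝓝 (∫ ω, F (fun m => Ξ (t m) ω) ∂P))

/-- The functional `exp(∑_m ∫ f_m dη_m)`, for functions `f_m` on `ℤ` of compact support. -/
def expFunctional {M : ℕ} (f : Fin M → ℤ →₀ ℝ) (η : Fin M → Config) : ℝ :=
  Real.exp (∑ m, (f m).sum fun x c => c * (η m x : ℝ))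

/-- The term of index `A = (A_1, …, A_M)` in the expansion of a generating function: `A_m` is the
set of points of `x^{(m)}` in the Weyl chamber, and `χ_m = e^{f_m} - 1`. -/
def expansionTerm {M : ℕ} (f : Fin M → ℤ →₀ ℝ) (ρ : (Fin M → Finset ℤ) → ℂ)
    (A : Fin M → Finset ℤ) : ℂ :=
  (∏ m, ∏ x ∈ A m, ((Real.exp (f m x) - 1 : ℝ) : ℂ)) * ρ A

/-- `det [K(t_m, x; t_n, y)]` with rows `(m, x)`, `x ∈ A_m`, and columns `(n, y)`, `y ∈ A_n`. -/
def detKernel (K : ℝ≥0 → ℤ → ℝ≥0 → ℤ → ℂ) {M : ℕ} (t : Fin M → ℝ≥0) (A : Fin M → Finset ℤ) : ℂ :=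
  Matrix.det (Matrix.of fun p q : (Σ m : Fin M, A m) => K (t p.1) p.2 (t q.1) q.2)

/-- The functions `ρ` are the spatio-temporal correlation functions of `(Ξ, P)`: every multitime
moment generating function is finite and has the expansion with coefficients `ρ`. -/
def HasCorrelationFunctions {Ω : Type*} [MeasurableSpace Ω] (P : Measure Ω)
    (Ξ : ℝ≥0 → Ω → Config) (ρ : ∀ M : ℕ, (Fin M → ℝ≥0) → (Fin M → Finset ℤ) → ℂ) : Prop :=
  ∀ (M : ℕ) (t : Fin M → ℝ≥0), StrictMono t → ∀ f : Fin M → ℤ →₀ ℝ,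
    Integrable (fun ω => expFunctional f (fun m => Ξ (t m) ω)) P ∧
    HasSum (expansionTerm f (ρ M t))
      ((∫ ω, expFunctional f (fun m => Ξ (t m) ω) ∂P : ℝ) : ℂ)

/-- `(Ξ, P)` is determinantal with correlation kernel `K`: every multitime moment generating
function is the Fredholm determinant of `K`, i.e. the correlation functions are the determinants
of `K`. -/
def IsDeterminantal {Ω : Type*} [MeasurableSpace Ω] (P : Measure Ω)
    (Ξ : ℝ≥0 → Ω → Config) (K : ℝ≥0 → ℤ → ℝ≥0 → ℤ → ℂ) : Prop :=
  HasCorrelationFunctions P Ξ (fun _ t A => detKernel K t A)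

/-- The kernel
`∑_j I_{|x-aj|}(s) (1/2π) ∫_{-π}^{π} e^{iλ(y/a-j) - t cos(λ/a)} dλ - 1(s > t) I_{|x-y|}(s-t)`. -/
def kernel (a : ℕ) (s : ℝ≥0) (x : ℤ) (t : ℝ≥0) (y : ℤ) : ℂ :=
  (∑' j : ℤ, ((besselI (x - a * j).natAbs s : ℝ) : ℂ) *
    ((1 / (2 * Real.pi) : ℂ) * ∫ l : ℝ in (-Real.pi)..Real.pi,
      Complex.exp (Complex.I * l * ((y : ℂ) / a - j) - t * Complex.cos ((l : ℂ) / a))))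
  - (if t < s then ((besselI (x - y).natAbs ((s : ℝ) - t) : ℝ) : ℂ) else 0)

end

end NoncollidingRW

/-! ### Bessel generating function, Fourier form of `hatM`, transition probabilities. -/

namespace NoncollidingRW

noncomputable section

/-! In Fourier form `hatM a k t y` is a mixture of exponentials `exp (t - t cos (λ/a) + iλ(y/a -
k))`, so `hatM a k t (V t)` is a martingale for each walk (`integral_hatM_add`), with initial value
`δ_{jk}` for the walk labelled `j`.

For one walk, expand the weight `∏ (1 + χ_m(V(t_m)))` against this martingale by the Markov
property. The result is `δ_{jk}` plus a sum over visited space-time points of transition probability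
times `χ U`, where `U = M + Q U` and `Q` is strictly triangular in time (`exists_chain_expansion`).

By independence the determinantal expectation over `J` is the determinant of the one-walk
expectations, `det (1 + P_J U_J)`. Sylvester's identity moves it to the finite space-time window,
and multiplying by `det (1 - Q) = 1` turns it into `det (1 - Q + M_J P_J)`. The size of this matrix
no longer depends on `J`, and its entries are partial sums of convergent series, so the limit
exists; up to conjugation and transposition it is the Fredholm determinant of `kernel`
(`tendsto_dmrExpectation_expFunctional`), and its principal minors give the expansion.

For a process `Ξ` the representation covers only bounded functionals. It forces `Ξ` to have no
multiple points, because a collision gives `hatD` two equal rows. Hence every generating function is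
a finite combination of the moments `E ∏ Ξ(x)`. Nonpositive `f`, for which the functional is
bounded, suffice to identify these moments with `detKernel`, and the expansion then holds for all
`f`. -/

/-- Pairs of natural numbers, parametrised by their difference and their minimum. -/
def diffMinEquiv : ℕ × ℕ ≃ ℤ × ℕ where
  toFun p := ((p.1 : ℤ) - p.2, min p.1 p.2)
  invFun q := (q.2 + q.1.toNat, q.2 + (-q.1).toNat)
  left_inv p := by ext <;> simp <;> omega
  right_inv q := by ext <;> simp; omega

/-- The terms of the double expansion of `exp (t cos z)`. -/
def besselTerm (t z : ℝ) (q : ℤ × ℕ) : ℂ :=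
  ((t / 2 : ℝ) : ℂ) ^ (q.1.natAbs + 2 * q.2) / ((q.2.factorial : ℂ) * (q.2 + q.1.natAbs).factorial)
    * Complex.exp (Complex.I * z * q.1)

/-- If `n = k - l` and `ℓ = min k l`, then `k + l = |n| + 2ℓ` and `{k, l} = {ℓ, ℓ + |n|}`. The
double series is thus the product of the exponential series of `(t/2) e^{iz}` and `(t/2) e^{-iz}`.
-/
lemma besselTerm_diffMinEquiv (t z : ℝ) (p : ℕ × ℕ) :
    besselTerm t z (diffMinEquiv p) =
      (((t / 2 : ℝ) : ℂ) * Complex.exp (Complex.I * z)) ^ p.1 / p.1.factorial *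
      ((((t / 2 : ℝ) : ℂ) * Complex.exp (-(Complex.I * z))) ^ p.2 / p.2.factorial) := by
  obtain ⟨k, l⟩ := p
  have hexp : Complex.exp (Complex.I * z * ((k : ℤ) - (l : ℤ) : ℤ)) =
      Complex.exp (Complex.I * z) ^ k * Complex.exp (-(Complex.I * z)) ^ l := by
    rw [← Complex.exp_nat_mul, ← Complex.exp_nat_mul, ← Complex.exp_add]
    congr 1
    push_cast
    ring
  have hpow : ((k : ℤ) - (l : ℤ)).natAbs + 2 * min k l = k + l := by omega
  have hfac : ((min k l).factorial : ℂ) * (min k l + ((k : ℤ) - (l : ℤ)).natAbs).factorial =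
      (k.factorial : ℂ) * l.factorial := by
    rcases le_total k l with h | h
    · rw [min_eq_left h, show k + ((k : ℤ) - (l : ℤ)).natAbs = l by omega]
    · rw [min_eq_right h, show l + ((k : ℤ) - (l : ℤ)).natAbs = k by omega, mul_comm]
  simp only [besselTerm, diffMinEquiv, Equiv.coe_fn_mk, hexp, hpow, hfac, mul_pow, pow_add]
  field_simp

lemma norm_exp_I_mul (x : ℝ) : ‖Complex.exp (Complex.I * x)‖ = 1 := by
  rw [mul_comm, Complex.norm_exp_ofReal_mul_I]

lemma hasSum_expSeries (x : ℂ) : HasSum (fun k : ℕ => x ^ k / k.factorial) (Complex.exp x) := by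
  rw [Complex.exp_eq_exp_ℂ]
  exact NormedSpace.expSeries_div_hasSum_exp x

lemma summable_norm_expSeries_mul (x y : ℂ) :
    Summable fun p : ℕ × ℕ => ‖x ^ p.1 / p.1.factorial * (y ^ p.2 / p.2.factorial)‖ :=
  Summable.mul_norm (f := fun k : ℕ => x ^ k / k.factorial) (g := fun l : ℕ => y ^ l / l.factorial)
    (NormedSpace.norm_expSeries_div_summable x) (NormedSpace.norm_expSeries_div_summable y)

lemma summable_norm_besselTerm (t z : ℝ) : Summable fun q => ‖besselTerm t z q‖ := by
  rw [← diffMinEquiv.summable_iff]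
  simp only [Function.comp_def, besselTerm_diffMinEquiv]
  exact summable_norm_expSeries_mul _ _

lemma hasSum_besselTerm (t z : ℝ) :
    HasSum (besselTerm t z) (Complex.exp (t * Complex.cos z)) := by
  rw [← diffMinEquiv.hasSum_iff]
  simp only [Function.comp_def, besselTerm_diffMinEquiv]
  have h : (t : ℂ) * Complex.cos z = ((t / 2 : ℝ) : ℂ) * Complex.exp (Complex.I * z) +
      ((t / 2 : ℝ) : ℂ) * Complex.exp (-(Complex.I * z)) := by
    rw [Complex.cos, mul_comm Complex.I, ← neg_mul]
    push_cast
    ring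
  rw [h, Complex.exp_add]
  exact HasSum.mul (f := fun k : ℕ => (((t / 2 : ℝ) : ℂ) * Complex.exp (Complex.I * z)) ^ k / k.factorial)
    (g := fun l : ℕ => (((t / 2 : ℝ) : ℂ) * Complex.exp (-(Complex.I * z))) ^ l / l.factorial)
    (hasSum_expSeries _) (hasSum_expSeries _) (summable_norm_expSeries_mul _ _).of_norm

lemma hasSum_besselTerm_fiber (t z : ℝ) (n : ℤ) :
    HasSum (fun l => besselTerm t z (n, l))
      ((besselI n.natAbs t : ℂ) * Complex.exp (Complex.I * z * n)) := by
  have hs : Summable fun l => besselTerm t z (n, l) :=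
    (summable_norm_besselTerm t z).of_norm.prod_factor n
  convert! hs.hasSum using 1
  simp only [besselTerm, besselI, tsum_mul_right]
  congr 1
  rw [Complex.ofReal_mul, Complex.ofReal_tsum, ← tsum_mul_left]
  refine tsum_congr fun l => ?_
  rw [show ((n.natAbs : ℝ) + l + 1) = ((l + n.natAbs : ℕ) : ℝ) + 1 by push_cast; ring,
    Real.Gamma_nat_eq_factorial, pow_add]
  push_cast
  ring

lemma hasSum_besselI_mul_exp (t z : ℝ) :
    HasSum (fun n : ℤ => (besselI n.natAbs t : ℂ) * Complex.exp (Complex.I * z * n))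
      (Complex.exp (t * Complex.cos z)) :=
  (hasSum_besselTerm t z).prod_fiberwise (hasSum_besselTerm_fiber t z)

lemma norm_exp_I_mul_int (z : ℝ) (n : ℤ) : ‖Complex.exp (Complex.I * z * n)‖ = 1 := by
  rw [mul_assoc]
  exact_mod_cast norm_exp_I_mul (z * n)

/-- Fibre sums of an absolutely convergent double series. Negative `t` is included, since
`transformS` evaluates `besselI` at `-t`. -/
lemma summable_abs_besselI (t : ℝ) : Summable fun n : ℤ => |besselI n.natAbs t| := by
  have h := summable_norm_besselTerm t 0
  refine Summable.of_nonneg_of_le (fun _ => abs_nonneg _) (fun n => ?_) h.prod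
  have h1 := (hasSum_besselTerm_fiber t 0 n).tsum_eq
  have h2 := norm_tsum_le_tsum_norm (h.prod_factor n)
  rwa [h1, norm_mul, norm_exp_I_mul_int, mul_one, Complex.norm_real, Real.norm_eq_abs] at h2

lemma summable_norm_besselI (t : ℝ) : Summable fun n : ℤ => ‖(besselI n.natAbs t : ℂ)‖ := by
  simpa using summable_abs_besselI t

/-- Termwise integration of an absolutely summable series of bounded continuous functions. -/
lemma hasSum_integral_mul_of_bounded {c : ℤ → ℂ} (hc : Summable fun n => ‖c n‖)
    {g : ℤ → ℝ → ℂ} (hg : ∀ n, Continuous (g n)) {C : ℝ} (hC : ∀ n x, ‖g n x‖ ≤ C)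
    {f : ℝ → ℂ} (hf : ∀ x, HasSum (fun n => c n * g n x) (f x)) (u v : ℝ) :
    HasSum (fun n => c n * ∫ x in u..v, g n x) (∫ x in u..v, f x) := by
  simp only [← intervalIntegral.integral_const_mul]
  refine intervalIntegral.hasSum_integral_of_dominated_convergence (fun n _ => ‖c n‖ * C)
    (fun n => ((hg n).const_mul _).aestronglyMeasurable) ?_ ?_ ?_ ?_
  · exact fun n => ae_of_all _ fun x _ => by
      rw [norm_mul]
      exact mul_le_mul_of_nonneg_left (hC n x) (norm_nonneg _)
  · exact ae_of_all _ fun _ _ => hc.mul_right C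
  · exact intervalIntegrable_const
  · exact ae_of_all _ fun x _ => hf x

lemma integral_exp_I_mul (u : ℝ) :
    ∫ l : ℝ in (-Real.pi)..Real.pi, Complex.exp (Complex.I * l * u) =
      2 * Real.pi * Real.sinc (Real.pi * u) := by
  rcases eq_or_ne u 0 with rfl | hu
  · simp
    ring
  have h := intervalIntegral.integral_comp_mul_left (a := -Real.pi) (b := Real.pi)
    (fun x : ℝ => Complex.exp (x * Complex.I)) hu
  rw [mul_neg, integral_exp_mul_I_eq_sinc] at h
  rw [mul_comm Real.pi u]
  have hu' : (u : ℂ) ≠ 0 := by exact_mod_cast hu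
  calc _ = ∫ x : ℝ in (-Real.pi)..Real.pi, Complex.exp ((u * x : ℝ) * Complex.I) := by
        congr 1 with x
        congr 1
        push_cast
        ring
    _ = _ := by
        rw [h]
        simp only [Complex.real_smul]
        push_cast
        field_simp

lemma sinc_pi_mul_int (n : ℤ) : Real.sinc (Real.pi * n) = if n = 0 then 1 else 0 := by
  split_ifs with h
  · simp [h]
  · have : (n : ℝ) ≠ 0 := by exact_mod_cast h
    rw [Real.sinc_of_ne_zero (mul_ne_zero Real.pi_ne_zero this), mul_comm, Real.sin_int_mul_pi,
      zero_div]

lemma integral_exp_I_mul_int (n : ℤ) :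
    ∫ l : ℝ in (-Real.pi)..Real.pi, Complex.exp (Complex.I * l * n) =
      if n = 0 then 2 * (Real.pi : ℂ) else 0 := by
  have h := integral_exp_I_mul n
  rw [sinc_pi_mul_int] at h
  push_cast at h
  rw [h]
  split_ifs <;> simp

/-- Fourier coefficients of the generating function of the Bessel functions. -/
lemma integral_exp_mul_cos (t : ℝ) (m : ℤ) :
    ∫ l : ℝ in (-Real.pi)..Real.pi, Complex.exp (t * Complex.cos l) * Complex.exp (-(Complex.I * l * m))
      = 2 * Real.pi * besselI m.natAbs t := by
  have h := hasSum_integral_mul_of_bounded (summable_norm_besselI t)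
    (g := fun n l => Complex.exp (Complex.I * l * (n - m : ℤ))) (fun n => by fun_prop) (C := 1)
    (fun n x => (norm_exp_I_mul_int x (n - m)).le)
    (f := fun l => Complex.exp (t * Complex.cos l) * Complex.exp (-(Complex.I * l * m)))
    (fun x => by
      convert! (hasSum_besselI_mul_exp t x).mul_right (Complex.exp (-(Complex.I * x * m))) using 2 with n
      rw [mul_assoc (besselI _ _ : ℂ), ← Complex.exp_add]
      congr 2
      push_cast
      ring) (-Real.pi) Real.pi
  rw [← h.tsum_eq, tsum_eq_single m]
  · rw [integral_exp_I_mul_int]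
    simp
    ring
  · intro n hn
    rw [integral_exp_I_mul_int, if_neg (sub_ne_zero.mpr hn), mul_zero]

/-- The Fourier representation of the transformed functions. -/
lemma hatM_eq_integral (a : ℕ) (k : ℤ) (t : ℝ≥0) (y : ℤ) :
    (hatM a k t y : ℂ) = (Real.exp t : ℂ) * ((1 / (2 * Real.pi) : ℂ) *
      ∫ l : ℝ in (-Real.pi)..Real.pi,
        Complex.exp (Complex.I * l * ((y : ℂ) / a - k) - t * Complex.cos ((l : ℂ) / a))) := by
  rw [hatM, transformS, Complex.ofReal_mul, Complex.ofReal_tsum]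
  congr 1
  -- `hatPhi` is itself the Fourier integral of `e^{iλ(w/a - k)}` over `[-π, π]`. With `w = y + n`,
  -- summing over `n` under the integral is the Bessel generating function at `-t` and angle `λ/a`.
  have h := hasSum_integral_mul_of_bounded (summable_norm_besselI (-t))
    (g := fun n l => Complex.exp (Complex.I * l * (((y + n : ℤ) / a - k : ℝ)))) (fun n => by fun_prop)
    (C := 1) (fun n x => by
      rw [mul_assoc]; exact_mod_cast (norm_exp_I_mul (x * ((y + n : ℤ) / a - k))).le)
    (f := fun l => Complex.exp (Complex.I * l * ((y : ℂ) / a - k) - t * Complex.cos ((l : ℂ) / a)))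
    (fun x => by
      convert! (hasSum_besselI_mul_exp (-t) (x / a)).mul_left
        (Complex.exp (Complex.I * x * ((y : ℂ) / a - k))) using 1
      · ext n
        rw [mul_left_comm, ← Complex.exp_add]
        congr 2
        push_cast
        ring
      · rw [← Complex.exp_add]
        congr 1
        push_cast
        ring) (-Real.pi) Real.pi
  rw [← h.tsum_eq, ← tsum_mul_left, ← (Equiv.addLeft y).tsum_eq]
  refine tsum_congr fun n => ?_
  rw [integral_exp_I_mul]
  simp only [Equiv.coe_addLeft, add_sub_cancel_left, hatPhi]
  have hpi : (Real.pi : ℂ) ≠ 0 := by exact_mod_cast Real.pi_ne_zero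
  push_cast
  field_simp

/-- Uniformity in `k` and `y` comes from `|sinc| ≤ 1`; it serves both integrability and summation
over labels. -/
lemma abs_hatM_le (a : ℕ) (t : ℝ≥0) :
    ∃ C : ℝ, 0 ≤ C ∧ ∀ k y, |hatM a k t y| ≤ C := by
  refine ⟨Real.exp t * ∑' n : ℤ, |besselI n.natAbs (-t)|, by positivity, fun k y => ?_⟩
  rw [hatM, transformS, abs_mul, abs_of_pos (Real.exp_pos _)]
  refine mul_le_mul_of_nonneg_left ?_ (Real.exp_pos _).le
  rw [← (Equiv.addLeft y).tsum_eq]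
  simp only [Equiv.coe_addLeft, add_sub_cancel_left]
  have hle : ∀ n : ℤ, ‖besselI n.natAbs (-t) * hatPhi a k (y + n : ℤ)‖ ≤ |besselI n.natAbs (-t)| :=
    fun n => by
      rw [norm_mul, Real.norm_eq_abs]
      exact mul_le_of_le_one_right (abs_nonneg _) (Real.abs_sinc_le_one _)
  exact tsum_of_norm_bounded (summable_abs_besselI (-t)).hasSum hle

lemma hatM_zero (a : ℕ) (k : ℤ) (y : ℤ) : hatM a k 0 y = hatPhi a k y := by
  have h := hatM_eq_integral a k 0 y
  have h2 := integral_exp_I_mul ((y : ℝ) / a - k)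
  push_cast at h2
  have hpi : (Real.pi : ℂ) ≠ 0 := by exact_mod_cast Real.pi_ne_zero
  simp only [NNReal.coe_zero, Complex.ofReal_zero, zero_mul, sub_zero, Real.exp_zero,
    Complex.ofReal_one, one_mul, h2] at h
  rw [hatPhi]
  apply Complex.ofReal_injective
  rw [h]
  field_simp

/-- Interpolation at the starting points: this supplies the identity matrix in `1 + P_J U_J`. -/
lemma hatPhi_mul_int {a : ℕ} (ha : a ≠ 0) (k j : ℤ) :
    hatPhi a k ((a * j : ℤ) : ℝ) = if j = k then 1 else 0 := by
  have ha' : (a : ℝ) ≠ 0 := by exact_mod_cast ha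
  rw [hatPhi]
  have : Real.pi * (((a * j : ℤ) : ℝ) / a - k) = Real.pi * ((j - k : ℤ) : ℝ) := by
    push_cast
    field_simp
  rw [this, sinc_pi_mul_int]
  simp only [sub_eq_zero]

/-- The transition probability of the walk. -/
def stepProb (τ : ℝ) (n : ℤ) : ℝ := Real.exp (-τ) * besselI n.natAbs τ

lemma summable_abs_stepProb (τ : ℝ) : Summable fun n => |stepProb τ n| := by
  simp only [stepProb, abs_mul]
  exact (summable_abs_besselI τ).mul_left _

variable {Ω : Type*} [MeasurableSpace Ω] {P : Measure Ω} [IsProbabilityMeasure P]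

lemma integral_intervalIntegral_swap {X : Ω → ℤ} (hX : Measurable X)
    {f : ℤ → ℝ → ℂ} (hf : ∀ n, Continuous (f n)) {C : ℝ} (hC : ∀ n x, ‖f n x‖ ≤ C) {u v : ℝ} (huv : u ≤ v) :
    ∫ ω, (∫ l in u..v, f (X ω) l) ∂P = ∫ l in u..v, (∫ ω, f (X ω) l ∂P) := by
  simp only [intervalIntegral.integral_of_le huv]
  refine integral_integral_swap ?_
  refine Integrable.of_bound (C := C) (Measurable.aestronglyMeasurable ?_)
    (ae_of_all _ fun _ => hC _ _)
  have h : Measurable fun p : ℝ × ℤ => f p.2 p.1 :=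
    measurable_from_prod_countable_left fun n => (hf n).measurable
  exact h.comp (measurable_snd.prodMk (hX.comp measurable_fst))

/-- Fourier inversion: integrating `e^{il(X - m)}` over a period isolates the event `X = m`. -/
lemma measureReal_eq_stepProb {X : Ω → ℤ} (hX : Measurable X) {τ : ℝ}
    (hchar : ∀ z : ℝ, ∫ ω, Complex.exp (Complex.I * z * ((X ω : ℤ) : ℂ)) ∂P
      = Complex.exp (τ * (Complex.cos z - 1))) (m : ℤ) :
    P.real {ω | X ω = m} = stepProb τ m := by
  have hpi : (Real.pi : ℂ) ≠ 0 := by exact_mod_cast Real.pi_ne_zero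
  have hswap := integral_intervalIntegral_swap (P := P) hX
    (f := fun n l => Complex.exp (Complex.I * l * (n - m : ℤ))) (fun n => by fun_prop) (C := 1)
    (fun n x => (norm_exp_I_mul_int x _).le) (u := -Real.pi) (v := Real.pi) (by linarith [Real.pi_pos])
  have hl : ∀ ω, (∫ l : ℝ in (-Real.pi)..Real.pi, Complex.exp (Complex.I * l * (X ω - m : ℤ))) =
      Set.indicator {ω | X ω = m} (fun _ => 2 * (Real.pi : ℂ)) ω := fun ω => by
    rw [integral_exp_I_mul_int, Set.indicator_apply]
    simp only [sub_eq_zero, Set.mem_ofPred_eq]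
  have hr : ∀ l : ℝ, (∫ ω, Complex.exp (Complex.I * l * (X ω - m : ℤ)) ∂P) =
      Real.exp (-τ) * (Complex.exp (τ * Complex.cos l) * Complex.exp (-(Complex.I * l * m))) :=
    fun l => by
      have : ∀ ω, Complex.exp (Complex.I * l * (X ω - m : ℤ)) =
          Complex.exp (Complex.I * l * (X ω : ℤ)) * Complex.exp (-(Complex.I * l * m)) := fun ω => by
        rw [← Complex.exp_add]
        congr 1
        push_cast
        ring
      simp only [this]
      rw [integral_mul_const, hchar, Complex.ofReal_exp, ← Complex.exp_add, ← Complex.exp_add,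
        ← Complex.exp_add]
      congr 1
      push_cast
      ring
  simp only [hl, hr] at hswap
  rw [integral_indicator_const _ (measurableSet_eq_fun hX measurable_const), intervalIntegral.integral_const_mul,
    integral_exp_mul_cos, Complex.real_smul] at hswap
  apply Complex.ofReal_injective
  have h2 : (2 * Real.pi : ℂ) ≠ 0 := mul_ne_zero two_ne_zero hpi
  apply mul_right_cancel₀ h2
  rw [hswap, stepProb]
  push_cast
  ring

/-- The martingale property. Averaging the mode of frequency `λ/a` multiplies it by `exp ((t-s)(cos
(λ/a) - 1))`, which changes `exp (t - t cos (λ/a))` into the same factor at time `s`. -/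
lemma integral_hatM_add {X : Ω → ℤ} (hX : Measurable X) {s t : ℝ≥0}
    (hchar : ∀ z : ℝ, ∫ ω, Complex.exp (Complex.I * z * ((X ω : ℤ) : ℂ)) ∂P
      = Complex.exp (((t : ℂ) - s) * (Complex.cos z - 1))) (a : ℕ) (k x : ℤ) :
    ∫ ω, hatM a k t (x + X ω) ∂P = hatM a k s x := by
  apply Complex.ofReal_injective
  rw [← integral_complex_ofReal]
  simp only [hatM_eq_integral]
  rw [integral_const_mul, integral_const_mul, integral_intervalIntegral_swap (P := P) hX
    (f := fun n l => Complex.exp (Complex.I * l * (((x + n : ℤ) : ℂ) / a - k)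
      - t * Complex.cos ((l : ℂ) / a))) (fun n => by fun_prop) (C := Real.exp t) ?_
      (by linarith [Real.pi_pos])]
  · rw [mul_left_comm, mul_left_comm (Real.exp s : ℂ)]
    congr 1
    rw [← intervalIntegral.integral_const_mul, ← intervalIntegral.integral_const_mul]
    congr 1 with l
    have h := hchar (l / a)
    have : ∀ ω, Complex.exp (Complex.I * l * (((x + X ω : ℤ) : ℂ) / a - k)
      - t * Complex.cos ((l : ℂ) / a)) = Complex.exp (Complex.I * (l / a : ℝ) * ((X ω : ℤ) : ℂ)) *
        Complex.exp (Complex.I * l * ((x : ℂ) / a - k) - t * Complex.cos ((l : ℂ) / a)) := fun ω => by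
      rw [← Complex.exp_add]
      congr 1
      push_cast
      ring
    simp only [this]
    rw [integral_mul_const, h, Complex.ofReal_exp, Complex.ofReal_exp, ← Complex.exp_add,
      ← Complex.exp_add, ← Complex.exp_add]
    congr 1
    push_cast
    ring
  · intro n l
    rw [Complex.norm_exp]
    refine Real.exp_le_exp.mpr ?_
    have h1 : (Complex.I * l * (((x + n : ℤ) : ℂ) / a - k) - t * Complex.cos ((l : ℂ) / a)) =
        ((-(t * Real.cos (l / a)) : ℝ) : ℂ) + ((l * ((x + n : ℤ) / a - k) : ℝ) : ℂ) * Complex.I := by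
      push_cast
      ring
    rw [h1, Complex.add_re, Complex.ofReal_re, Complex.re_ofReal_mul, Complex.I_re, mul_zero, add_zero]
    nlinarith [Real.neg_one_le_cos (l / a), t.coe_nonneg]

/-- The prefactor `e^{s-t}` is a conjugation and disappears from determinants. -/
lemma kernel_eq (a : ℕ) (s : ℝ≥0) (x : ℤ) (t : ℝ≥0) (y : ℤ) :
    kernel a s x t y = ((Real.exp (s - t) * ((∑' j : ℤ, stepProb s (x - a * j) * hatM a j t y) -
      if t < s then stepProb (s - t) (x - y) else 0) : ℝ) : ℂ) := by
  rw [kernel, mul_sub, Complex.ofReal_sub, ← tsum_mul_left, Complex.ofReal_tsum]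
  congr 1
  · refine tsum_congr fun j => ?_
    rw [stepProb, Complex.ofReal_mul, Complex.ofReal_mul, hatM_eq_integral]
    have h : ((Real.exp (s - t) : ℝ) : ℂ) * (Real.exp (-s) : ℝ) * (Real.exp t : ℝ) = 1 := by
      rw [← Complex.ofReal_mul, ← Complex.ofReal_mul, ← Real.exp_add, ← Real.exp_add,
        show (s : ℝ) - t + -s + t = 0 by ring]
      simp
    rw [Complex.ofReal_mul]
    linear_combination (-((besselI (x - a * j).natAbs s : ℝ) : ℂ) *
      ((1 / (2 * Real.pi) : ℂ) * ∫ l : ℝ in (-Real.pi)..Real.pi,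
      Complex.exp (Complex.I * l * ((y : ℂ) / a - j) - t * Complex.cos ((l : ℂ) / a)))) * h
  · split_ifs
    · rw [stepProb, ← mul_assoc, ← Real.exp_add]
      simp
    · simp

end

end NoncollidingRW

/-! ### One walk: Markov property and the triangular system. -/

namespace NoncollidingRW

noncomputable section

set_option linter.unusedSectionVars false

variable {Ω : Type*} [MeasurableSpace Ω] {P : Measure Ω} [IsProbabilityMeasure P]

/-- The σ-algebra generated by the first `m` increments of `W` along the times `τ`. -/
@[reducible]
def pastIncrements (W : ℝ≥0 → Ω → ℤ) (τ : ℕ → ℝ≥0) (m : ℕ) : MeasurableSpace Ω :=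
  MeasurableSpace.comap (fun ω (i : Finset.range m) => W (τ (i + 1)) ω - W (τ i) ω) inferInstance

lemma measurable_increment_pastIncrements {W : ℝ≥0 → Ω → ℤ} {τ : ℕ → ℝ≥0} {i m : ℕ} (h : i < m) :
    Measurable[pastIncrements W τ m] fun ω => W (τ (i + 1)) ω - W (τ i) ω := by
  have h1 : Measurable fun x : Finset.range m → ℤ => x ⟨i, Finset.mem_range.mpr h⟩ :=
    measurable_pi_apply _
  exact h1.comp (comap_measurable _)

lemma pastIncrements_mono {W : ℝ≥0 → Ω → ℤ} {τ : ℕ → ℝ≥0} {m n : ℕ} (h : m ≤ n) :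
    pastIncrements W τ m ≤ pastIncrements W τ n := by
  refine Measurable.comap_le ?_
  refine @measurable_pi_lambda _ _ _ (pastIncrements W τ n) _ _ fun i => ?_
  exact measurable_increment_pastIncrements ((Finset.mem_range.mp i.2).trans_le h)

/-- The start is prescribed at every `ω`, because the σ-algebra of increments need not contain null
sets; `fixStart` removes this restriction. -/
lemma measurable_pastIncrements {W : ℝ≥0 → Ω → ℤ} {τ : ℕ → ℝ≥0} {x : ℤ}
    (h0 : ∀ ω, W (τ 0) ω = x) {i m : ℕ} (h : i ≤ m) :
    Measurable[pastIncrements W τ m] (W (τ i)) := by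
  induction i with
  | zero =>
    rw [show W (τ 0) = fun _ => x from funext h0]
    exact measurable_const
  | succ i ih =>
    have h1 := Measurable.add (ih (by omega))
      (measurable_increment_pastIncrements (W := W) (τ := τ) (show i < m by omega))
    convert! h1 using 1
    ext ω
    simp

lemma pastIncrements_le {W : ℝ≥0 → Ω → ℤ} (hW : ∀ t, Measurable (W t)) (τ : ℕ → ℝ≥0) (m : ℕ) :
    pastIncrements W τ m ≤ ‹MeasurableSpace Ω› :=
  Measurable.comap_le (measurable_pi_lambda _ fun _ => (hW _).sub (hW _))

/-- The increment from `τ m` to `τ n` is a sum over the block `Ico m n`, disjoint from the block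
`range m` that carries the past. -/
lemma indepFun_pastIncrements {W : ℝ≥0 → Ω → ℤ} (hW : ∀ t, Measurable (W t))
    (hind : HasIndepIncrements W P) {τ : ℕ → ℝ≥0} (hτ : Monotone τ) {m n : ℕ} (hmn : m ≤ n)
    {β : Type*} [MeasurableSpace β] {φ : Ω → β} (hφ : Measurable[pastIncrements W τ m] φ) :
    IndepFun φ (fun ω => W (τ n) ω - W (τ m) ω) P := by
  have h1 := (hind.nat hτ).indepFun_finset (Finset.range m) (Finset.Ico m n)
    (by
      rw [Finset.disjoint_left]
      intro i hi hi'
      simp at hi hi'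
      omega) fun i => (hW _).sub (hW _)
  have h2 : (fun ω => W (τ n) ω - W (τ m) ω) = (fun x : Finset.Ico m n → ℤ => ∑ i, x i) ∘
      fun ω (i : Finset.Ico m n) => W (τ (i + 1)) ω - W (τ i) ω := by
    ext ω
    simp only [Function.comp]
    rw [Finset.sum_coe_sort (Finset.Ico m n) fun i => W (τ (i + 1)) ω - W (τ i) ω,
      Finset.sum_Ico_sub (fun i => W (τ i) ω) hmn]
  rw [h2]
  have h3 := h1.comp measurable_id (measurable_of_countable fun x : Finset.Ico m n → ℤ => ∑ i, x i)
  rw [IndepFun_iff_Indep] at h3 ⊢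
  exact indep_of_indep_of_le_left h3 hφ.comap_le

lemma integral_indepFun {β γ : Type*} [MeasurableSpace β] [MeasurableSpace γ] {X : Ω → β} {Y : Ω → γ}
    (hX : Measurable X) (hY : Measurable Y) (h : IndepFun X Y P) {F : β × γ → ℝ}
    (hF : Measurable F) {C : ℝ} (hC : ∀ ω ω', |F (X ω, Y ω')| ≤ C) :
    ∫ ω, F (X ω, Y ω) ∂P = ∫ ω, (∫ ω', F (X ω, Y ω') ∂P) ∂P := by
  have : IsProbabilityMeasure (P.map X) := Measure.isProbabilityMeasure_map hX.aemeasurable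
  have : IsProbabilityMeasure (P.map Y) := Measure.isProbabilityMeasure_map hY.aemeasurable
  have h1 := (indepFun_iff_map_prod_eq_prod_map_map hX.aemeasurable hY.aemeasurable).mp h
  have hint : Integrable F ((P.map X).prod (P.map Y)) := by
    rw [Measure.map_prod_map P P hX hY, integrable_map_measure hF.aestronglyMeasurable
      (hX.prodMap hY).aemeasurable]
    exact Integrable.of_bound (hF.comp (hX.prodMap hY)).aestronglyMeasurable C
      (ae_of_all _ fun p => hC p.1 p.2)
  rw [← integral_map (f := F) (hX.prodMk hY).aemeasurable hF.aestronglyMeasurable, h1,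
    integral_prod _ hint, integral_map hX.aemeasurable
      hint.aestronglyMeasurable.integral_prod_right']
  refine integral_congr_ae (ae_of_all _ fun ω => ?_)
  exact integral_map hY.aemeasurable (hF.comp measurable_prodMk_left).aestronglyMeasurable

/-- The Markov property at a time of the sequence `τ`. -/
lemma integral_mul_increment {W : ℝ≥0 → Ω → ℤ} (hW : ∀ t, Measurable (W t))
    (hind : HasIndepIncrements W P) {τ : ℕ → ℝ≥0} (hτ : Monotone τ) {x : ℤ}
    (h0 : ∀ ω, W (τ 0) ω = x) {m n : ℕ} (hmn : m ≤ n) {φ : Ω → ℝ}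
    (hφ : Measurable[pastIncrements W τ m] φ) {C : ℝ} (hC : ∀ ω, |φ ω| ≤ C)
    (g : ℤ × ℤ → ℝ) {D : ℝ} (hD : ∀ p, |g p| ≤ D) :
    ∫ ω, φ ω * g (W (τ m) ω, W (τ n) ω - W (τ m) ω) ∂P =
      ∫ ω, φ ω * (∫ ω', g (W (τ m) ω, W (τ n) ω' - W (τ m) ω') ∂P) ∂P := by
  have hpair : Measurable[pastIncrements W τ m] fun ω => (φ ω, W (τ m) ω) :=
    hφ.prodMk (measurable_pastIncrements h0 le_rfl)
  have hF : Measurable fun q : (ℝ × ℤ) × ℤ => q.1.1 * g (q.1.2, q.2) :=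
    (measurable_fst.comp measurable_fst).mul ((measurable_of_countable g).comp
      ((measurable_snd.comp measurable_fst).prodMk measurable_snd))
  have h := integral_indepFun (hpair.mono (pastIncrements_le hW τ m) le_rfl) ((hW (τ n)).sub (hW (τ m)))
    (indepFun_pastIncrements hW hind hτ hmn hpair) hF (C := C * D) fun ω ω' => by
      simp only [abs_mul]
      exact mul_le_mul (hC ω) (hD _) (abs_nonneg _) ((abs_nonneg _).trans (hC ω))
  simp only [integral_const_mul] at h
  exact h

lemma IsRandomWalk.measurable_increment {W : ℝ≥0 → Ω → ℤ} {x : ℤ} (hW : IsRandomWalk P W x)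
    (s t : ℝ≥0) : Measurable fun ω => W t ω - W s ω :=
  (hW.measurable t).sub (hW.measurable s)

lemma IsRandomWalk.integral_mul_hatM {W : ℝ≥0 → Ω → ℤ} {x : ℤ} (hW : IsRandomWalk P W x)
    {τ : ℕ → ℝ≥0} (hτ : Monotone τ) (h0 : ∀ ω, W (τ 0) ω = x) {m n : ℕ} (hmn : m ≤ n)
    {φ : Ω → ℝ} (hφ : Measurable[pastIncrements W τ m] φ) {C : ℝ} (hC : ∀ ω, |φ ω| ≤ C)
    (a : ℕ) (k : ℤ) :
    ∫ ω, φ ω * hatM a k (τ n) (W (τ n) ω) ∂P = ∫ ω, φ ω * hatM a k (τ m) (W (τ m) ω) ∂P := by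
  obtain ⟨D, -, hD⟩ := abs_hatM_le a (τ n)
  have h := integral_mul_increment hW.measurable hW.indepIncrements hτ h0 hmn hφ hC
    (fun p => hatM a k (τ n) (p.1 + p.2)) fun p => hD k _
  simp only [add_sub_cancel] at h
  rw [h]
  refine integral_congr_ae (ae_of_all _ fun ω => ?_)
  exact congrArg (φ ω * ·) (integral_hatM_add (hW.measurable_increment (τ m) (τ n))
    (hW.charFun_increment _ _ (hτ hmn)) a k _)

lemma IsRandomWalk.measureReal_increment {W : ℝ≥0 → Ω → ℤ} {x : ℤ} (hW : IsRandomWalk P W x)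
    {s t : ℝ≥0} (hst : s ≤ t) (n : ℤ) :
    P.real {ω | W t ω - W s ω = n} = stepProb (t - s) n :=
  measureReal_eq_stepProb (hW.measurable_increment s t)
    (fun z => by rw [hW.charFun_increment s t hst]; push_cast; rfl) n

lemma integral_ite_eq {X : Ω → ℤ} (hX : Measurable X) (n : ℤ) :
    ∫ ω, (if X ω = n then (1 : ℝ) else 0) ∂P = P.real {ω | X ω = n} := by
  have := integral_indicator_one (μ := P) (measurableSet_eq_fun hX (measurable_const (a := n)))
  rw [← this]
  congr 1 with ω
  simp [Set.indicator_apply]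

lemma IsRandomWalk.integral_mul_ite_ite {W : ℝ≥0 → Ω → ℤ} {x : ℤ} (hW : IsRandomWalk P W x)
    {τ : ℕ → ℝ≥0} (hτ : Monotone τ) (h0 : ∀ ω, W (τ 0) ω = x) {m n : ℕ} (hmn : m ≤ n)
    {φ : Ω → ℝ} (hφ : Measurable[pastIncrements W τ m] φ) {C : ℝ} (hC : ∀ ω, |φ ω| ≤ C)
    (u v : ℤ) :
    ∫ ω, φ ω * ((if W (τ m) ω = u then 1 else 0) * (if W (τ n) ω = v then 1 else 0)) ∂P =
      (∫ ω, φ ω * (if W (τ m) ω = u then 1 else 0) ∂P) * stepProb (τ n - τ m) (v - u) := by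
  have h := integral_mul_increment hW.measurable hW.indepIncrements hτ h0 hmn hφ hC
    (fun p => (if p.1 = u then 1 else 0) * (if p.2 = v - u then 1 else 0)) (D := 1)
    fun p => by split_ifs <;> simp
  simp only at h
  rw [← integral_mul_const]
  refine Eq.trans (integral_congr_ae (ae_of_all _ fun ω => ?_)) (h.trans
    (integral_congr_ae (ae_of_all _ fun ω => ?_)))
  · simp only
    congr 1
    by_cases h1 : W (τ m) ω = u
    · simp [h1, sub_left_inj]
    · simp [h1]
  · simp only
    rw [integral_const_mul (if W (τ m) ω = u then (1 : ℝ) else 0)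
      (fun ω' => if W (τ n) ω' - W (τ m) ω' = v - u then (1 : ℝ) else 0),
      integral_ite_eq (hW.measurable_increment (τ m) (τ n)),
      hW.measureReal_increment (hτ hmn), mul_assoc]

/-- The solution `U` of `U = M + Q U`, where `M = hatM` and `Q` is the strictly triangular matrix of
transition probabilities between the sites of `F` at the times `τ 1, …, τ N`, weighted by `χ`. -/
def chainSol (a : ℕ) (k : ℤ) (τ : ℕ → ℝ≥0) (χ : ℕ → ℤ → ℝ) (F : Finset ℤ) (N : ℕ) (n : ℕ) (y : ℤ) : ℝ :=
  hatM a k (τ n) y + ∑ l ∈ (Finset.Ico (n + 1) (N + 1)).attach, ∑ z ∈ F,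
    stepProb (τ l - τ n) (z - y) * (χ l z * chainSol a k τ χ F N l z)
termination_by N + 1 - n
decreasing_by have := Finset.mem_Ico.mp l.2; omega

lemma chainSol_eq (a : ℕ) (k : ℤ) (τ : ℕ → ℝ≥0) (χ : ℕ → ℤ → ℝ) (F : Finset ℤ) (N : ℕ) (n : ℕ) (y : ℤ) :
    chainSol a k τ χ F N n y = hatM a k (τ n) y + ∑ l ∈ Finset.Ico (n + 1) (N + 1), ∑ z ∈ F,
      stepProb (τ l - τ n) (z - y) * (χ l z * chainSol a k τ χ F N l z) := by
  rw [chainSol, Finset.sum_attach (Finset.Ico (n + 1) (N + 1)) fun l => ∑ z ∈ F,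
      stepProb (τ l - τ n) (z - y) * (χ l z * chainSol a k τ χ F N l z)]

lemma exists_abs_le_of_support {χ : ℤ → ℝ} {F : Finset ℤ} (hχ : ∀ y, y ∉ F → χ y = 0) :
    ∃ C : ℝ, ∀ y, |χ y| ≤ C := by
  refine ⟨∑ y ∈ F, |χ y|, fun y => ?_⟩
  by_cases hy : y ∈ F
  · exact Finset.single_le_sum (f := fun y => |χ y|) (fun _ _ => abs_nonneg _) hy
  · rw [hχ y hy, abs_zero]
    exact Finset.sum_nonneg fun _ _ => abs_nonneg _

lemma eq_sum_ite_of_support {χ : ℤ → ℝ} {F : Finset ℤ} (hχ : ∀ y, y ∉ F → χ y = 0) (w : ℤ) :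
    χ w = ∑ y ∈ F, (if w = y then 1 else 0) * χ y := by
  simp only [ite_mul, one_mul, zero_mul, Finset.sum_ite_eq]
  split_ifs with h
  · rfl
  · exact hχ w h

/-- Induction on the number `d` of remaining weights, for an arbitrary bounded past weight `φ`: the
factor `1 + χ (m + 1)` is absorbed into `φ`. With no weights left, the martingale property carries
`hatM` from `τ (N + 1)` back to `τ m`. -/
lemma IsRandomWalk.integral_mul_prod_mul_hatM {W : ℝ≥0 → Ω → ℤ} {x : ℤ} (hW : IsRandomWalk P W x)
    {τ : ℕ → ℝ≥0} (hτ : Monotone τ) (h0 : ∀ ω, W (τ 0) ω = x) (a : ℕ) (k : ℤ)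
    {χ : ℕ → ℤ → ℝ} {F : Finset ℤ} (hχ : ∀ n y, y ∉ F → χ n y = 0) (N d m : ℕ) (hd : m + d = N)
    {φ : Ω → ℝ} (hφ : Measurable[pastIncrements W τ m] φ) {C : ℝ} (hC : ∀ ω, |φ ω| ≤ C) :
    ∫ ω, φ ω * ((∏ n ∈ Finset.Ico (m + 1) (N + 1), (1 + χ n (W (τ n) ω))) *
        hatM a k (τ (N + 1)) (W (τ (N + 1)) ω)) ∂P =
      ∫ ω, φ ω * hatM a k (τ m) (W (τ m) ω) ∂P + ∑ n ∈ Finset.Ico (m + 1) (N + 1), ∑ y ∈ F,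
        (∫ ω, φ ω * (if W (τ n) ω = y then 1 else 0) ∂P) * (χ n y * chainSol a k τ χ F N n y) := by
  induction d generalizing m φ C with
  | zero =>
    obtain rfl : m = N := by omega
    simp only [Finset.Ico_self, Finset.prod_empty, one_mul, Finset.sum_empty, add_zero]
    exact hW.integral_mul_hatM hτ h0 (by omega) hφ hC a k
  | succ d ih =>
    have hφm : Measurable φ := hφ.mono (pastIncrements_le hW.measurable τ m) le_rfl
    have hφ1 : Measurable[pastIncrements W τ (m + 1)] φ :=
      hφ.mono (pastIncrements_mono (by omega)) le_rfl
    obtain ⟨D, hD⟩ := exists_abs_le_of_support (hχ (m + 1))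
    obtain ⟨B, -, hB⟩ := abs_hatM_le a (τ (m + 1))
    have hχm : Measurable[pastIncrements W τ (m + 1)] fun ω => χ (m + 1) (W (τ (m + 1)) ω) :=
      (measurable_of_countable (χ (m + 1))).comp (measurable_pastIncrements h0 le_rfl)
    have hint : ∀ {g : Ω → ℝ} {b : ℝ}, Measurable g → (∀ ω, |g ω| ≤ b) →
        Integrable (fun ω => φ ω * g ω) P := fun {g b} hg hb =>
      Integrable.of_bound (hφm.mul hg).aestronglyMeasurable (C * b) (ae_of_all _ fun ω => by
        rw [norm_mul]
        exact mul_le_mul (hC ω) (hb ω) (norm_nonneg _) ((abs_nonneg _).trans (hC ω)))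
    have hite : ∀ n y, Measurable fun ω => if W (τ n) ω = y then (1 : ℝ) else 0 := fun n y =>
      (measurable_of_countable fun w : ℤ => if w = y then (1 : ℝ) else 0).comp (hW.measurable _)
    have hite1 : ∀ n y ω, |if W (τ n) ω = y then (1 : ℝ) else 0| ≤ 1 := fun n y ω => by
      split_ifs <;> simp
    have hsplit : Finset.Ico (m + 1) (N + 1) = insert (m + 1) (Finset.Ico (m + 1 + 1) (N + 1)) :=
      (Finset.insert_Ico_succ_left_eq_Ico (by omega)).symm
    have hnot : m + 1 ∉ Finset.Ico (m + 1 + 1) (N + 1) := by simp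
    have key := ih (m + 1) (by omega) (φ := fun ω => φ ω * (1 + χ (m + 1) (W (τ (m + 1)) ω)))
      (hφ1.mul (hχm.const_add 1)) (C := C * (1 + D)) fun ω => by
        rw [abs_mul]
        refine mul_le_mul (hC ω) ?_ (abs_nonneg _) ((abs_nonneg _).trans (hC ω))
        exact (abs_add_le _ _).trans (by simpa using hD _)
    rw [hsplit, Finset.sum_insert hnot]
    simp only [Finset.prod_insert hnot]
    refine Eq.trans (integral_congr_ae (ae_of_all _ fun ω => ?_)) (key.trans ?_)
    · simp only
      ring
    -- the contribution of the site visited at time `τ (m + 1)`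
    have hM : ∫ ω, φ ω * (1 + χ (m + 1) (W (τ (m + 1)) ω)) * hatM a k (τ (m + 1)) (W (τ (m + 1)) ω) ∂P
        = ∫ ω, φ ω * hatM a k (τ m) (W (τ m) ω) ∂P + ∑ y ∈ F,
          (∫ ω, φ ω * (if W (τ (m + 1)) ω = y then 1 else 0) ∂P) *
            (χ (m + 1) y * hatM a k (τ (m + 1)) y) := by
      rw [← hW.integral_mul_hatM hτ h0 (Nat.le_succ m) hφ hC a k]
      simp only [← integral_mul_const]
      rw [← integral_finsetSum _ fun y _ => (hint (hite _ _) (hite1 _ y)).mul_const _, ← integral_add]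
      · refine integral_congr_ae (ae_of_all _ fun ω => ?_)
        have := eq_sum_ite_of_support (χ := fun y => χ (m + 1) y * hatM a k (τ (m + 1)) y) (F := F)
          (fun y hy => by simp [hχ _ y hy]) (W (τ (m + 1)) ω)
        simp only [mul_assoc, ← Finset.mul_sum]
        rw [← this]
        ring
      · exact hint ((measurable_of_countable (hatM a k (τ (m + 1)))).comp (hW.measurable _))
          fun ω => hB k _
      · exact integrable_finsetSum _ fun y _ => (hint (hite _ _) (hite1 _ y)).mul_const _
    -- Later sites are reached either with the old weight `φ`, or through a site `y` at time `τ (m +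
    -- 1)`, where the Markov property splits off a transition probability.
    have hQ : ∀ n ∈ Finset.Ico (m + 1 + 1) (N + 1), ∀ v,
        ∫ ω, φ ω * (1 + χ (m + 1) (W (τ (m + 1)) ω)) * (if W (τ n) ω = v then 1 else 0) ∂P =
          ∫ ω, φ ω * (if W (τ n) ω = v then 1 else 0) ∂P + ∑ y ∈ F,
            (∫ ω, φ ω * (if W (τ (m + 1)) ω = y then 1 else 0) ∂P) *
              (χ (m + 1) y * stepProb (τ n - τ (m + 1)) (v - y)) := by
      intro n hn v
      have hmn : m + 1 ≤ n := by have := Finset.mem_Ico.mp hn; omega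
      have hprod : ∀ y ω, |(if W (τ (m + 1)) ω = y then (1 : ℝ) else 0) *
          (if W (τ n) ω = v then 1 else 0)| ≤ 1 := fun y ω => by split_ifs <;> simp
      have hint2 : ∀ y, Integrable (fun ω => φ ω * ((if W (τ (m + 1)) ω = y then 1 else 0) *
          (if W (τ n) ω = v then 1 else 0)) * χ (m + 1) y) P := fun y =>
        (hint ((hite _ _).mul (hite _ _)) (hprod y)).mul_const _
      have h1 : ∀ y, (∫ ω, φ ω * (if W (τ (m + 1)) ω = y then 1 else 0) ∂P) *
          (χ (m + 1) y * stepProb (τ n - τ (m + 1)) (v - y)) =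
          ∫ ω, φ ω * ((if W (τ (m + 1)) ω = y then 1 else 0) *
            (if W (τ n) ω = v then 1 else 0)) * χ (m + 1) y ∂P := fun y => by
        rw [integral_mul_const, hW.integral_mul_ite_ite hτ h0 hmn hφ1 hC]
        ring
      simp only [h1]
      rw [← integral_finsetSum _ fun y _ => hint2 y,
        ← integral_add (hint (hite _ _) (hite1 _ _))]
      · refine integral_congr_ae (ae_of_all _ fun ω => ?_)
        have := eq_sum_ite_of_support (hχ (m + 1)) (W (τ (m + 1)) ω)
        simp only
        rw [this, mul_add, mul_one, add_mul, Finset.mul_sum, Finset.sum_mul]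
        congr 1
        exact Finset.sum_congr rfl fun y _ => by ring
      · exact integrable_finsetSum _ fun y _ => hint2 y
    rw [hM, Finset.sum_congr rfl fun n hn => Finset.sum_congr rfl fun v _ => by rw [hQ n hn v]]
    rw [add_assoc]
    congr 1
    simp only [add_mul, Finset.sum_add_distrib]
    rw [add_left_comm, add_comm]
    congr 1
    -- What passes through `y` at time `τ (m + 1)` is `χ` times a `hatM` term plus transitions to
    -- later sites, which is the recursion for `chainSol` at `m + 1`.
    simp only [chainSol_eq a k τ χ F N (m + 1), mul_add, Finset.sum_add_distrib]
    congr 1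
    simp only [Finset.sum_mul, Finset.mul_sum]
    rw [Finset.sum_comm (s := F)]
    refine Finset.sum_congr rfl fun n _ => ?_
    rw [Finset.sum_comm]
    exact Finset.sum_congr rfl fun y _ => Finset.sum_congr rfl fun v _ => by ring

lemma IsRandomWalk.integral_prod_mul_hatM_of_forall {W : ℝ≥0 → Ω → ℤ} {x : ℤ} (hW : IsRandomWalk P W x)
    {τ : ℕ → ℝ≥0} (hτ : Monotone τ) (hτ0 : τ 0 = 0) (h0 : ∀ ω, W 0 ω = x) (a : ℕ) (k : ℤ)
    {χ : ℕ → ℤ → ℝ} {F : Finset ℤ} (hχ : ∀ n y, y ∉ F → χ n y = 0) (N : ℕ) :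
    ∫ ω, (∏ n ∈ Finset.Ico 1 (N + 1), (1 + χ n (W (τ n) ω))) *
        hatM a k (τ (N + 1)) (W (τ (N + 1)) ω) ∂P =
      hatPhi a k x + ∑ n ∈ Finset.Ico 1 (N + 1), ∑ y ∈ F,
        stepProb (τ n) (y - x) * (χ n y * chainSol a k τ χ F N n y) := by
  have h0' : ∀ ω, W (τ 0) ω = x := fun ω => by rw [hτ0, h0]
  have h := hW.integral_mul_prod_mul_hatM hτ h0' a k hχ N N 0 (zero_add N) (φ := fun _ => 1)
    measurable_const (C := 1) fun _ => by simp
  simp only [one_mul, zero_add] at h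
  rw [h]
  congr 1
  · simp [h0, hτ0, hatM_zero]
  · refine Finset.sum_congr rfl fun n _ => Finset.sum_congr rfl fun y _ => ?_
    have h1 := hW.measureReal_increment (zero_le : 0 ≤ τ n) (y - x)
    simp only [h0, sub_left_inj, NNReal.coe_zero, sub_zero] at h1
    rw [integral_ite_eq (hW.measurable _), h1]

/-- The walk with its starting point corrected on a null set. -/
def fixStart (W : ℝ≥0 → Ω → ℤ) (x : ℤ) (t : ℝ≥0) (ω : Ω) : ℤ := x + (W t ω - W 0 ω)

lemma IsRandomWalk.fixStart_ae_eq {W : ℝ≥0 → Ω → ℤ} {x : ℤ} (hW : IsRandomWalk P W x) :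
    ∀ᵐ ω ∂P, ∀ t, fixStart W x t ω = W t ω := by
  filter_upwards [hW.initial] with ω hω t
  simp [fixStart, hω]

lemma IsRandomWalk.fixStart {W : ℝ≥0 → Ω → ℤ} {x : ℤ} (hW : IsRandomWalk P W x) :
    IsRandomWalk P (fixStart W x) x where
  measurable t := ((hW.measurable t).sub (hW.measurable 0)).const_add x
  initial := ae_of_all _ fun ω => by simp [NoncollidingRW.fixStart]
  indepIncrements n t ht := by
    simpa [NoncollidingRW.fixStart] using hW.indepIncrements n t ht
  charFun_increment s t hst z := by
    simpa only [NoncollidingRW.fixStart, add_sub_add_left_eq_sub, sub_sub_sub_cancel_right]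
      using hW.charFun_increment s t hst z
  cadlag := by
    filter_upwards [hW.cadlag, hW.fixStart_ae_eq] with ω hω h t
    simp only [h]
    exact hω t

lemma IsRandomWalk.integral_prod_mul_hatM {W : ℝ≥0 → Ω → ℤ} {x : ℤ} (hW : IsRandomWalk P W x)
    {τ : ℕ → ℝ≥0} (hτ : Monotone τ) (hτ0 : τ 0 = 0) (a : ℕ) (k : ℤ)
    {χ : ℕ → ℤ → ℝ} {F : Finset ℤ} (hχ : ∀ n y, y ∉ F → χ n y = 0) (N : ℕ) :
    ∫ ω, (∏ n ∈ Finset.Ico 1 (N + 1), (1 + χ n (W (τ n) ω))) *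
        hatM a k (τ (N + 1)) (W (τ (N + 1)) ω) ∂P =
      hatPhi a k x + ∑ n ∈ Finset.Ico 1 (N + 1), ∑ y ∈ F,
        stepProb (τ n) (y - x) * (χ n y * chainSol a k τ χ F N n y) := by
  rw [← hW.fixStart.integral_prod_mul_hatM_of_forall hτ hτ0
    (fun ω => by simp [NoncollidingRW.fixStart]) a k hχ N]
  refine integral_congr_ae ?_
  filter_upwards [hW.fixStart_ae_eq] with ω h
  simp only [h]

end

end NoncollidingRW

/-! ### The determinantal expectation and its limit. -/

namespace NoncollidingRW

noncomputable section

set_option linter.unusedSectionVars false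

variable {Ω : Type*} [MeasurableSpace Ω] {P : Measure Ω} [IsProbabilityMeasure P]

/-- The times `0, t 0, …, t (M - 1), T, T, …`. -/
def extendTimes {M : ℕ} (t : Fin M → ℝ≥0) (T : ℝ≥0) : ℕ → ℝ≥0
  | 0 => 0
  | n + 1 => if h : n < M then t ⟨n, h⟩ else T

lemma monotone_extendTimes {M : ℕ} {t : Fin M → ℝ≥0} {T : ℝ≥0} (ht : StrictMono t)
    (hT : ∀ m, t m ≤ T) : Monotone (extendTimes t T) := by
  refine monotone_nat_of_le_succ fun n => ?_
  cases n with
  | zero => simp [extendTimes]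
  | succ n =>
    simp only [extendTimes]
    split_ifs with h1 h2 h2
    · exact ht.monotone (by simp)
    · exact hT _
    · omega
    · exact le_rfl

lemma prod_Ico_one_succ {α : Type*} [CommMonoid α] (M : ℕ) (g : ℕ → α) :
    ∏ n ∈ Finset.Ico 1 (M + 1), g n = ∏ m : Fin M, g (m + 1) := by
  rw [Finset.prod_Ico_eq_prod_range, Finset.prod_range]
  exact Finset.prod_congr rfl fun m _ => by rw [add_comm]

lemma sum_Ico_one_succ (M : ℕ) (g : ℕ → ℝ) :
    ∑ n ∈ Finset.Ico 1 (M + 1), g n = ∑ m : Fin M, g (m + 1) := by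
  rw [Finset.sum_Ico_eq_sum_range, Finset.sum_range]
  exact Finset.sum_congr rfl fun m _ => by rw [add_comm]

/-- The one-walk expectations are affine in a solution of the triangular system `U = M + Q U`. -/
lemma exists_chain_expansion (P : Measure Ω) [IsProbabilityMeasure P] (a : ℕ) {M : ℕ}
    {t : Fin M → ℝ≥0} {T : ℝ≥0} (ht : StrictMono t) (hT : ∀ m, t m ≤ T) {χ : Fin M → ℤ → ℝ}
    {F : Finset ℤ} (hχ : ∀ m y, y ∉ F → χ m y = 0) :
    ∃ U : ℤ → Fin M → ℤ → ℝ,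
      (∀ k m y, U k m y = hatM a k (t m) y + ∑ n, ∑ z ∈ F,
        (if m < n then stepProb (t n - t m) (z - y) else 0) * χ n z * U k n z) ∧
      ∀ (W : ℝ≥0 → Ω → ℤ) (x : ℤ), IsRandomWalk P W x → ∀ k,
        ∫ ω, (∏ m, (1 + χ m (W (t m) ω))) * hatM a k T (W T ω) ∂P =
          hatPhi a k x + ∑ m, ∑ y ∈ F, stepProb (t m) (y - x) * χ m y * U k m y := by
  set τ := extendTimes t T with hτdef
  -- Indices are shifted by one because time `0` comes first. The value of `X 0` is junk and never
  -- enters, as all sums and products start at `1`.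
  set X : ℕ → ℤ → ℝ := fun n y => if h : n - 1 < M then χ ⟨n - 1, h⟩ y else 0 with hXdef
  have hX : ∀ n y, y ∉ F → X n y = 0 := fun n y hy => by
    simp only [hXdef]
    split_ifs with h
    · exact hχ _ y hy
    · rfl
  have hτt : ∀ m : Fin M, τ (m + 1) = t m := fun m => by simp [hτdef, extendTimes]
  have hτT : τ (M + 1) = T := by simp [hτdef, extendTimes]
  have hXχ : ∀ m : Fin M, X (m + 1) = χ m := fun m => by simp [hXdef]
  refine ⟨fun k m y => chainSol a k τ X F M (m + 1) y, fun k m y => ?_, fun W x hW k => ?_⟩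
  · beta_reduce
    rw [chainSol_eq a k τ X F M (m + 1) y, hτt]
    congr 1
    have hsub : Finset.Ico ((m : ℕ) + 1 + 1) (M + 1) =
        (Finset.Ico 1 (M + 1)).filter fun n => (m : ℕ) + 1 < n := by
      ext n
      simp only [Finset.mem_Ico, Finset.mem_filter]
      omega
    rw [hsub, Finset.sum_filter, sum_Ico_one_succ]
    refine Finset.sum_congr rfl fun n _ => ?_
    simp only [hτt, hXχ, add_lt_add_iff_right, Fin.val_fin_lt]
    split_ifs
    · exact Finset.sum_congr rfl fun z _ => by ring
    · simp
  · have h := hW.integral_prod_mul_hatM (monotone_extendTimes ht hT) rfl a k hX M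
    simp only [prod_Ico_one_succ, sum_Ico_one_succ] at h
    rw [← hτdef] at h
    simp only [hτt, hτT, hXχ] at h
    rw [h]
    congr 1
    exact Finset.sum_congr rfl fun m _ => Finset.sum_congr rfl fun y _ => by ring

lemma sum_mul_empirical (f : ℤ →₀ ℝ) (J : Finset ℤ) (v : ℤ → ℤ) :
    (f.sum fun x c => c * (empirical J v x : ℝ)) = ∑ j ∈ J, f (v j) := by
  simp only [Finsupp.sum, empirical, Finset.card_filter, Nat.cast_sum, Finset.mul_sum]
  rw [Finset.sum_comm]
  refine Finset.sum_congr rfl fun j _ => ?_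
  simp only [Nat.cast_ite, Nat.cast_one, Nat.cast_zero, mul_ite, mul_one, mul_zero,
    Finset.sum_ite_eq, Finsupp.mem_support_iff]
  split_ifs with h
  · rfl
  · exact (not_not.mp h).symm

lemma expFunctional_empirical {M : ℕ} (f : Fin M → ℤ →₀ ℝ) (J : Finset ℤ) (v : Fin M → ℤ → ℤ) :
    expFunctional f (fun m => empirical J (v m)) = ∏ j : J, ∏ m, Real.exp (f m (v m j)) := by
  simp only [expFunctional, sum_mul_empirical]
  rw [Finset.sum_comm, Real.exp_sum, ← Finset.prod_coe_sort]
  simp only [Real.exp_sum]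

/-- Expectation of a product of functionals of the walks against a determinant with one row for each
walk. -/
lemma integral_prod_mul_det {ι : Type*} [Fintype ι] [DecidableEq ι] {E : Type*} [MeasurableSpace E]
    {X : ι → Ω → E} (hX : ∀ i, Measurable (X i)) (hind : iIndepFun X P) {G : E → ℝ}
    (hG : Measurable G) {C : ℝ} (hC : ∀ e, |G e| ≤ C) {H : ι → E → ℝ} (hH : ∀ k, Measurable (H k))
    {D : ℝ} (hD : ∀ k e, |H k e| ≤ D) :
    ∫ ω, (∏ i, G (X i ω)) * Matrix.det (Matrix.of fun i k => H k (X i ω)) ∂P =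
      Matrix.det (Matrix.of fun i k => ∫ ω, G (X i ω) * H k (X i ω) ∂P) := by
  -- `det_apply'` permutes row indices; after transposition the `i`-th factor of each Leibniz term
  -- involves only `X i`, so independence factorises the term.
  rw [← Matrix.det_transpose, Matrix.det_apply']
  have h1 : ∀ ω, (∏ i, G (X i ω)) * Matrix.det (Matrix.of fun i k => H k (X i ω)) =
      ∑ σ : Equiv.Perm ι, ((Equiv.Perm.sign σ : ℤ) : ℝ) * ∏ i, (G (X i ω) * H (σ i) (X i ω)) := fun ω => by
    rw [← Matrix.det_transpose, Matrix.det_apply', Finset.mul_sum]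
    refine Finset.sum_congr rfl fun σ _ => ?_
    simp only [Matrix.transpose_apply, Matrix.of_apply, Finset.prod_mul_distrib]
    ring
  simp only [h1]
  have hmeas : ∀ σ : Equiv.Perm ι, ∀ i, Measurable fun e => G e * H (σ i) e := fun σ i =>
    hG.mul (hH _)
  rw [integral_finsetSum]
  · refine Finset.sum_congr rfl fun σ _ => ?_
    rw [integral_const_mul]
    congr 1
    exact hind.integral_fun_prod_comp (fun i => (hX i).aemeasurable)
      (f := fun i e => G e * H (σ i) e) fun i => (hmeas σ i).aestronglyMeasurable
  · refine fun σ _ => Integrable.const_mul ?_ _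
    refine Integrable.of_bound (C := ∏ _i : ι, C * D) (Measurable.aestronglyMeasurable
      (Finset.measurable_fun_prod _ fun i _ => (hmeas σ i).comp (hX i))) (ae_of_all _ fun ω => ?_)
    rw [Real.norm_eq_abs, Finset.abs_prod]
    refine Finset.prod_le_prod (fun _ _ => abs_nonneg _) fun i _ => ?_
    rw [abs_mul]
    exact mul_le_mul (hC _) (hD _ _) (abs_nonneg _) ((abs_nonneg _).trans (hC (X i ω)))

/-- A finite window containing the supports of all `f m`. -/
def window {M : ℕ} (f : Fin M → ℤ →₀ ℝ) : Finset ℤ := Finset.univ.biUnion fun m => (f m).support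

lemma apply_eq_zero_of_notMem_window {M : ℕ} (f : Fin M → ℤ →₀ ℝ) (m : Fin M) {y : ℤ}
    (hy : y ∉ window f) : f m y = 0 := by
  by_contra h
  exact hy (Finset.mem_biUnion.mpr ⟨m, Finset.mem_univ _, Finsupp.mem_support_iff.mpr h⟩)

lemma exists_abs_prod_exp_le {M : ℕ} (f : Fin M → ℤ →₀ ℝ) :
    ∃ C, ∀ v : Fin M → ℤ, |∏ m, Real.exp (f m (v m))| ≤ C := by
  choose C hC using fun m => exists_abs_le_of_support (χ := f m) (F := (f m).support)
    fun y hy => Finsupp.notMem_support_iff.mp hy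
  refine ⟨∏ m, Real.exp (C m), fun v => ?_⟩
  rw [Finset.abs_prod]
  refine Finset.prod_le_prod (fun _ _ => abs_nonneg _) fun m _ => ?_
  rw [abs_of_pos (Real.exp_pos _)]
  exact Real.exp_le_exp.mpr ((le_abs_self _).trans (hC m _))

lemma dmrExpectation_expFunctional {V : ℤ → ℝ≥0 → Ω → ℤ} {x : ℤ → ℤ}
    (hV : ∀ j, IsRandomWalk P (V j) (x j))
    (hindep : iIndepFun (fun (j : ℤ) (ω : Ω) (t : ℝ≥0) => V j t ω) P) (a : ℕ) {M : ℕ}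
    (t : Fin M → ℝ≥0) (T : ℝ≥0) (f : Fin M → ℤ →₀ ℝ) (J : Finset ℤ) :
    dmrExpectation P V a t T (expFunctional f) J =
      Matrix.det (Matrix.of fun j k : J =>
        ∫ ω, (∏ m, Real.exp (f m (V j (t m) ω))) * hatM a k T (V j T ω) ∂P) := by
  obtain ⟨C, hC⟩ := exists_abs_prod_exp_le f
  obtain ⟨D, -, hD⟩ := abs_hatM_le a T
  have h := integral_prod_mul_det (ι := J) (P := P) (X := fun j ω t => V j t ω)
    (fun j => measurable_pi_lambda _ fun s => (hV j).measurable s)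
    (hindep.precomp Subtype.val_injective) (G := fun w => ∏ m, Real.exp (f m (w (t m))))
    (Finset.measurable_fun_prod _ fun m _ =>
      (measurable_of_countable fun y => Real.exp (f m y)).comp (measurable_pi_apply (t m)))
    (fun w => hC fun m => w (t m)) (H := fun k w => hatM a k T (w T))
    (fun k => (measurable_of_countable (hatM a k T)).comp (measurable_pi_apply T))
    fun k w => hD k _
  rw [← h, dmrExpectation]
  simp only [expFunctional_empirical, hatD]

/-- The kernel up to conjugation, transposed. -/
def conjKernel (a : ℕ) {M : ℕ} (t : Fin M → ℝ≥0) (F : Finset ℤ) : Matrix (Fin M × F) (Fin M × F) ℝ :=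
  Matrix.of fun p q => ∑' j : ℤ, stepProb (t q.1) (q.2 - a * j) * hatM a j (t p.1) p.2 -
    if p.1 < q.1 then stepProb (t q.1 - t p.1) (q.2 - p.2) else 0

/-- Block triangular in time, with identity diagonal blocks. -/
lemma det_one_sub_of_strictlyTriangular {M : ℕ} {β : Type*} [Fintype β] [DecidableEq β]
    (Q : Matrix (Fin M × β) (Fin M × β) ℝ) (hQ : ∀ p q, ¬ p.1 < q.1 → Q p q = 0) :
    (1 - Q).det = 1 := by
  have htri : (1 - Q).BlockTriangular fun p => p.1 := fun p q hpq => by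
    rw [Matrix.sub_apply, hQ p q (not_lt.mpr hpq.le), Matrix.one_apply_ne, sub_zero]
    rintro rfl
    exact lt_irrefl _ hpq
  rw [htri.det_fintype]
  refine Finset.prod_eq_one fun m _ => ?_
  rw [show (1 - Q).toSquareBlock (fun p => p.1) m = 1 from ?_, Matrix.det_one]
  ext ⟨p, hp⟩ ⟨q, hq⟩
  simp only [Matrix.toSquareBlock_def, Matrix.of_apply, Matrix.sub_apply, Matrix.one_apply,
    Subtype.mk.injEq]
  rw [hQ p q (by rw [hp, hq]; exact lt_irrefl _), sub_zero]

lemma summable_stepProb_mul_hatM {a : ℕ} (ha : a ≠ 0) (s : ℝ) (y : ℤ) (t : ℝ≥0) (x : ℤ) :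
    Summable fun j : ℤ => stepProb s (y - a * j) * hatM a j t x := by
  obtain ⟨C, -, hC⟩ := abs_hatM_le a t
  have hinj : Function.Injective fun j : ℤ => y - a * j := fun i j h => by
    have : (a : ℤ) ≠ 0 := by exact_mod_cast ha
    exact mul_left_cancel₀ this (sub_right_injective h)
  refine Summable.of_norm_bounded (((summable_abs_stepProb s).comp_injective hinj).mul_right C)
    fun j => ?_
  rw [norm_mul]
  exact mul_le_mul_of_nonneg_left (hC j x) (norm_nonneg _)

/-- The limit of the determinantal martingale representation as a Fredholm determinant. -/
lemma tendsto_dmrExpectation_expFunctional {a : ℕ} (ha : a ≠ 0) {V : ℤ → ℝ≥0 → Ω → ℤ}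
    (hV : ∀ j : ℤ, IsRandomWalk P (V j) (a * j))
    (hindep : iIndepFun (fun (j : ℤ) (ω : Ω) (t : ℝ≥0) => V j t ω) P) {M : ℕ}
    {t : Fin M → ℝ≥0} {T : ℝ≥0} (ht : StrictMono t) (hT : ∀ m, t m ≤ T) (f : Fin M → ℤ →₀ ℝ) :
    Tendsto (dmrExpectation P V a t T (expFunctional f)) atTop
      (𝓝 (1 + Matrix.of fun p q => (Real.exp (f q.1 q.2) - 1) * conjKernel a t (window f) p q).det) := by
  set χ : Fin M → ℤ → ℝ := fun m y => Real.exp (f m y) - 1 with hχdef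
  have hχ : ∀ m y, y ∉ window f → χ m y = 0 := fun m y hy => by
    simp [hχdef, apply_eq_zero_of_notMem_window f m hy]
  obtain ⟨U, hU, hW⟩ := exists_chain_expansion P a ht hT hχ
  let Q : Matrix (Fin M × window f) (Fin M × window f) ℝ := Matrix.of fun p q =>
    (if p.1 < q.1 then stepProb (t q.1 - t p.1) (q.2 - p.2) else 0) * χ q.1 q.2
  let Pm (J : Finset ℤ) : Matrix J (Fin M × window f) ℝ := Matrix.of fun j q =>
    stepProb (t q.1) (q.2 - a * j) * χ q.1 q.2
  let Um (J : Finset ℤ) : Matrix (Fin M × window f) J ℝ := Matrix.of fun p k => U k p.1 p.2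
  let Mm (J : Finset ℤ) : Matrix (Fin M × window f) J ℝ := Matrix.of fun p k => hatM a k (t p.1) p.2
  have hsum : ∀ g : Fin M → ℤ → ℝ, ∑ m, ∑ y ∈ window f, g m y =
      ∑ p : Fin M × window f, g p.1 p.2 := fun g => by
    rw [Fintype.sum_prod_type]
    exact Finset.sum_congr rfl fun m _ => (Finset.sum_coe_sort (window f) (g m)).symm
  have hUm : ∀ J, (1 - Q) * Um J = Mm J := fun J => by
    ext p k
    rw [Matrix.sub_mul, Matrix.one_mul, Matrix.sub_apply, Matrix.mul_apply, sub_eq_iff_eq_add]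
    simp only [Um, Mm, Q, Matrix.of_apply]
    rw [hU, hsum]
  have hdmr : ∀ J, dmrExpectation P V a t T (expFunctional f) J = (1 - Q + Mm J * Pm J).det := fun J => by
    have hQ : (1 - Q).det = 1 := det_one_sub_of_strictlyTriangular Q fun p q h => by simp [Q, h]
    rw [dmrExpectation_expFunctional hV hindep]
    have h1 : (Matrix.of fun j k : J =>
        ∫ ω, (∏ m, Real.exp (f m (V j (t m) ω))) * hatM a k T (V j T ω) ∂P) = 1 + Pm J * Um J := by
      ext j k
      have h2 := hW (V j) (a * j) (hV j) k
      simp only [hχdef, add_sub_cancel] at h2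
      rw [Matrix.of_apply, h2, hatPhi_mul_int ha, Matrix.add_apply, Matrix.one_apply, Matrix.mul_apply]
      rw [hsum fun m y => stepProb (t m) (y - a * j) * (Real.exp (f m y) - 1) * U k m y]
      simp only [Pm, Um, Matrix.of_apply, hχdef, Subtype.ext_iff]
    -- Sylvester's identity replaces the `J × J` determinant by one on the space-time window; the
    -- factor `det (1 - Q) = 1` then trades the implicit `Um` for the explicit `Mm`.
    rw [h1, Matrix.det_one_add_mul_comm, ← one_mul (Matrix.det _), ← hQ, ← Matrix.det_mul,
      mul_add, mul_one, ← Matrix.mul_assoc, hUm]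
  rw [funext hdmr]
  -- Now `J` enters only through finite partial sums in the entries, so entrywise convergence is
  -- enough.
  refine ((Continuous.matrix_det continuous_id).tendsto _).comp ?_
  refine tendsto_pi_nhds.mpr fun p => tendsto_pi_nhds.mpr fun q => ?_
  have hlim := (((summable_stepProb_mul_hatM ha (t q.1) q.2 (t p.1) p.2).hasSum.mul_left
    (χ q.1 q.2)).const_add ((1 : Matrix (Fin M × window f) (Fin M × window f) ℝ) p q - Q p q))
  convert! hlim using 1
  · ext J
    simp only [Matrix.add_apply, Matrix.sub_apply, Matrix.mul_apply, Mm, Pm, Matrix.of_apply]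
    congr 1
    rw [← Finset.sum_coe_sort J fun j =>
      χ q.1 q.2 * (stepProb (t q.1) (q.2 - a * j) * hatM a j (t p.1) p.2)]
    exact Finset.sum_congr rfl fun j _ => by ring
  · congr 1
    simp only [Matrix.add_apply, Matrix.of_apply, conjKernel, Q, hχdef]
    ring

end

end NoncollidingRW

/-! ### Fredholm expansion and uniqueness of its coefficients. -/

namespace NoncollidingRW

noncomputable section

set_option linter.unusedSectionVars false

/-- A determinant `det (1 + L)` is the sum of the principal minors of `L`. -/
lemma det_one_add_eq_sum_minors {ι R : Type*} [Fintype ι] [DecidableEq ι] [CommRing R]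
    (L : Matrix ι ι R) :
    (1 + L).det = ∑ B : Finset ι, (L.submatrix (Subtype.val : B → ι) Subtype.val).det := by
  -- Multilinearity in the rows: `B` records the rows taken from `L`, and the remaining identity
  -- rows reduce the determinant to the minor on `B`.
  have h := (Matrix.detRowAlternating (R := R) (n := ι)).map_add_univ L.row (1 : Matrix ι ι R).row
  simp only [← Matrix.det_piecewise_one_eq_submatrix_det]
  rw [add_comm]
  exact h

/-- The tuple of finite sets of sites described by a finite set of space-time points. -/
def slices {M : ℕ} {F : Finset ℤ} (B : Finset (Fin M × F)) (m : Fin M) : Finset ℤ :=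
  (Finset.univ.filter fun y : F => (m, y) ∈ B).map (Function.Embedding.subtype _)

lemma mem_slices {M : ℕ} {F : Finset ℤ} {B : Finset (Fin M × F)} {m : Fin M} {y : ℤ} :
    y ∈ slices B m ↔ ∃ h : y ∈ F, (m, ⟨y, h⟩) ∈ B := by
  simp [slices]

lemma slices_injective {M : ℕ} {F : Finset ℤ} :
    Function.Injective (slices : Finset (Fin M × F) → Fin M → Finset ℤ) := by
  intro B B' h
  ext ⟨m, y, hy⟩
  have h1 : y ∈ slices B m ↔ y ∈ slices B' m := by rw [h]
  simpa [mem_slices, hy] using h1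

/-- The space-time points of `B`, listed time by time. -/
def slicesEquiv {M : ℕ} {F : Finset ℤ} (B : Finset (Fin M × F)) : (Σ m : Fin M, slices B m) ≃ B where
  toFun p := ⟨(p.1, ⟨p.2, (mem_slices.mp p.2.2).1⟩), (mem_slices.mp p.2.2).2⟩
  invFun q := ⟨q.1.1, ⟨q.1.2, mem_slices.mpr ⟨q.1.2.2, q.2⟩⟩⟩
  left_inv _ := rfl
  right_inv _ := rfl

lemma prod_slices {M : ℕ} {F : Finset ℤ} {α : Type*} [CommMonoid α] (B : Finset (Fin M × F))
    (g : Fin M → ℤ → α) : ∏ m, ∏ x ∈ slices B m, g m x = ∏ q : B, g q.1.1 q.1.2 := by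
  rw [← (slicesEquiv B).prod_comp, Fintype.prod_sigma]
  exact Finset.prod_congr rfl fun m _ => (Finset.prod_coe_sort (slices B m) (g m)).symm

/-- `χ_m` vanishes off the window, so only tuples of subsets of the window contribute; these are the
`slices` of sets of space-time points. -/
lemma hasSum_expansionTerm {M : ℕ} (f : Fin M → ℤ →₀ ℝ) (ρ : (Fin M → Finset ℤ) → ℂ) :
    HasSum (expansionTerm f ρ) (∑ B : Finset (Fin M × window f),
      (∏ q : B, ((Real.exp (f q.1.1 q.1.2) - 1 : ℝ) : ℂ)) * ρ (slices B)) := by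
  rw [← slices_injective.hasSum_iff (f := expansionTerm f ρ) (g := slices (F := window f))]
  · convert! hasSum_fintype _ using 1
    refine Finset.sum_congr rfl fun B _ => ?_
    rw [Function.comp, expansionTerm, prod_slices B fun m x => ((Real.exp (f m x) - 1 : ℝ) : ℂ)]
  · intro A hA
    have : ∃ m, ∃ x ∈ A m, x ∉ window f := by
      by_contra! h
      refine hA ⟨Finset.univ.filter fun p : Fin M × window f => (p.2 : ℤ) ∈ A p.1, ?_⟩
      funext m
      ext y
      simp only [mem_slices, Finset.mem_filter, Finset.mem_univ, true_and]
      exact ⟨fun ⟨_, h⟩ => h, fun hy => ⟨h m y hy, hy⟩⟩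
    obtain ⟨m, x, hx, hxf⟩ := this
    rw [expansionTerm, Finset.prod_eq_zero (Finset.mem_univ m), zero_mul]
    refine Finset.prod_eq_zero hx ?_
    simp [apply_eq_zero_of_notMem_window f m hxf]

/-- Neither the conjugation by `e^{t_m}` nor the transposition changes the determinant. Strict
monotonicity of `t` matches the order of indices in `conjKernel` with the order of times in
`kernel`. -/
lemma detKernel_slices (a : ℕ) {M : ℕ} {t : Fin M → ℝ≥0} (ht : StrictMono t) {F : Finset ℤ}
    (B : Finset (Fin M × F)) :
    detKernel (kernel a) t (slices B) =
      (((conjKernel a t F).submatrix (Subtype.val : B → Fin M × F) Subtype.val).det : ℂ) := by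
  let v : (Σ m : Fin M, slices B m) → ℝ := fun p => Real.exp (t p.1)
  let A : Matrix (Σ m : Fin M, slices B m) (Σ m : Fin M, slices B m) ℝ :=
    (((conjKernel a t F).submatrix (Subtype.val : B → Fin M × F) Subtype.val).submatrix
      (slicesEquiv B) (slicesEquiv B)).transpose
  have h1 : (Matrix.of fun p q : (Σ m : Fin M, slices B m) => kernel a (t p.1) p.2 (t q.1) q.2) =
      (Matrix.of fun p q => v p * (Matrix.of fun p q => (v q)⁻¹ * A p q) p q).map Complex.ofRealHom := by
    ext p q
    simp only [Matrix.of_apply, Matrix.map_apply, Complex.ofRealHom_eq_coe]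
    rw [kernel_eq]
    congr 1
    rw [← mul_assoc, ← Real.exp_neg, ← Real.exp_add, ← sub_eq_add_neg]
    simp only [A, Matrix.transpose_apply, Matrix.submatrix_apply, conjKernel, Matrix.of_apply,
      slicesEquiv, Equiv.coe_fn_mk, ht.lt_iff_lt]
  rw [detKernel, h1, ← RingHom.mapMatrix_apply, ← RingHom.map_det, Matrix.det_mul_column,
    Matrix.det_mul_row, ← mul_assoc, ← Finset.prod_mul_distrib, Matrix.det_transpose,
    Matrix.det_submatrix_equiv_self]
  simp [v]

/-- The Fredholm determinant of the kernel is the sum of its expansion. -/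
lemma hasSum_expansionTerm_kernel (a : ℕ) {M : ℕ} {t : Fin M → ℝ≥0} (ht : StrictMono t)
    (f : Fin M → ℤ →₀ ℝ) :
    HasSum (expansionTerm f (detKernel (kernel a) t))
      (((1 + Matrix.of fun p q =>
        (Real.exp (f q.1 q.2) - 1) * conjKernel a t (window f) p q).det : ℝ) : ℂ) := by
  convert! hasSum_expansionTerm f (detKernel (kernel a) t) using 1
  rw [det_one_add_eq_sum_minors, Complex.ofReal_sum]
  refine Finset.sum_congr rfl fun B _ => ?_
  have h := Matrix.det_mul_row (fun q : B => Real.exp (f q.1.1 q.1.2) - 1)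
    ((conjKernel a t (window f)).submatrix (Subtype.val : B → Fin M × window f) Subtype.val)
  rw [detKernel_slices a ht, ← Complex.ofReal_prod, ← Complex.ofReal_mul, ← h]
  rfl

/-- The coefficients of an expansion are determined by the generating functions of nonpositive
functions. -/
lemma eq_of_hasSum_expansionTerm {M : ℕ} {ρ ρ' : (Fin M → Finset ℤ) → ℂ}
    (h : ∀ f : Fin M → ℤ →₀ ℝ, (∀ m x, f m x ≤ 0) →
      ∃ S, HasSum (expansionTerm f ρ) S ∧ HasSum (expansionTerm f ρ') S) : ρ = ρ' := by
  funext A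
  induction A using WellFoundedLT.induction with
  | ind A ih =>
    -- With `f = -1` on `A` and `0` elsewhere, only `A' ≤ A` contribute. Proper subtuples cancel by
    -- induction, and the term at `A` has a nonzero factor, a power of `e^{-1} - 1`.
    let f : Fin M → ℤ →₀ ℝ := fun m => Finsupp.indicator (A m) fun _ _ => (-1 : ℝ)
    have hf : ∀ m x, f m x = if x ∈ A m then -1 else 0 := fun m x => by
      simp [f, Finsupp.indicator_apply]
    obtain ⟨S, h1, h2⟩ := h f fun m x => by rw [hf]; split_ifs <;> norm_num
    have h3 := h1.sub h2
    have hzero : ∀ A', A' ≠ A → expansionTerm f ρ A' - expansionTerm f ρ' A' = 0 := by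
      intro A' hne
      by_cases hle : A' ≤ A
      · rw [expansionTerm, expansionTerm, ih A' (lt_of_le_of_ne hle hne), sub_self]
      · obtain ⟨m, hm⟩ : ∃ m, ¬ A' m ≤ A m := by simpa [Pi.le_def] using hle
        obtain ⟨x, hx, hxA⟩ := Finset.not_subset.mp hm
        have h0 : ∏ m, ∏ x ∈ A' m, ((Real.exp (f m x) - 1 : ℝ) : ℂ) = 0 :=
          Finset.prod_eq_zero (Finset.mem_univ m) (Finset.prod_eq_zero hx (by simp [hf, hxA]))
        rw [expansionTerm, expansionTerm, h0, zero_mul, zero_mul, sub_self]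
    have h4 := h3.unique (hasSum_single A hzero)
    rw [sub_self, eq_comm, sub_eq_zero, expansionTerm, expansionTerm] at h4
    refine mul_left_cancel₀ (Finset.prod_ne_zero_iff.mpr fun m _ =>
      Finset.prod_ne_zero_iff.mpr fun x hx => ?_) h4
    rw [hf, if_pos hx, Complex.ofReal_ne_zero, sub_ne_zero]
    simp

lemma isLocal_expFunctional {M : ℕ} (f : Fin M → ℤ →₀ ℝ) : IsLocal (expFunctional f) := by
  refine ⟨window f, fun η η' h => ?_⟩
  rw [expFunctional, expFunctional]
  congr 1
  refine Finset.sum_congr rfl fun m _ => Finset.sum_congr rfl fun x hx => ?_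
  have hx' : x ∈ window f := Finset.mem_biUnion.mpr ⟨m, Finset.mem_univ _, hx⟩
  simp only [h m x hx']

lemma abs_expFunctional_le_one {M : ℕ} {f : Fin M → ℤ →₀ ℝ} (hf : ∀ m x, f m x ≤ 0)
    (η : Fin M → Config) : |expFunctional f η| ≤ 1 := by
  rw [expFunctional, abs_of_pos (Real.exp_pos _), Real.exp_le_one_iff]
  exact Finset.sum_nonpos fun m _ => Finset.sum_nonpos fun x _ =>
    mul_nonpos_of_nonpos_of_nonneg (hf m x) (Nat.cast_nonneg _)

/-- For `η ∈ {0, 1}` one has `e^{fη} = 1 + (e^f - 1)η`; the product over the window is then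
expanded. -/
lemma expFunctional_eq_sum {M : ℕ} (f : Fin M → ℤ →₀ ℝ) {η : Fin M → Config}
    (hη : ∀ m x, η m x ≤ 1) :
    expFunctional f η = ∑ B : Finset (Fin M × window f),
      (∏ q : B, (Real.exp (f q.1.1 q.1.2) - 1)) * ∏ m, ∏ x ∈ slices B m, (η m x : ℝ) := by
  have h1 : ∀ m, ((f m).sum fun x c => c * (η m x : ℝ)) = ∑ y : window f, f m y * η m y := fun m => by
    rw [Finset.sum_coe_sort (window f) fun y => f m y * (η m y : ℝ)]
    refine Finset.sum_subset (fun y hy => Finset.mem_biUnion.mpr ⟨m, Finset.mem_univ _, hy⟩)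
      fun y _ hy => ?_
    simp [Finsupp.notMem_support_iff.mp hy]
  simp only [expFunctional, h1]
  rw [← Fintype.sum_prod_type' (f := fun m (y : window f) => f m y * (η m y : ℝ)), Real.exp_sum]
  have h2 : ∀ p : Fin M × window f, Real.exp (f p.1 p.2 * (η p.1 p.2 : ℝ)) =
      1 + (Real.exp (f p.1 p.2) - 1) * (η p.1 p.2 : ℝ) := fun p => by
    have := hη p.1 p.2
    interval_cases η p.1 p.2 <;> simp
  simp only [h2]
  rw [Finset.prod_one_add, Finset.powerset_univ]
  refine Finset.sum_congr rfl fun B _ => ?_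
  rw [prod_slices B fun m x => (η m x : ℝ), ← Finset.prod_mul_distrib, Finset.prod_coe_sort B
    fun q => (Real.exp (f q.1 q.2) - 1) * (η q.1 q.2 : ℝ)]

/-! ### Absence of multiple points, and moments of a noncolliding walk. -/

variable {Ω' : Type*} [MeasurableSpace Ω'] {P' : Measure Ω'} {V : ℤ → ℝ≥0 → Ω' → ℤ} {a : ℕ}
  {Ω : Type*} [MeasurableSpace Ω] {P : Measure Ω} [IsProbabilityMeasure P] {Ξ : ℝ≥0 → Ω → Config}

/-- Two labels at the same site give two equal rows. -/
lemma hatD_eq_zero_of_collision (J : Finset ℤ) (t : ℝ≥0) {v : ℤ → ℤ} {x : ℤ}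
    (h : 2 ≤ empirical J v x) : hatD a J t v = 0 := by
  obtain ⟨i, hi, j, hj, hij⟩ := Finset.one_lt_card.mp h
  rw [Finset.mem_filter] at hi hj
  refine Matrix.det_zero_of_row_eq (i := (⟨i, hi.1⟩ : J)) (j := ⟨j, hj.1⟩) ?_ ?_
  · simpa using hij
  · funext k
    simp [hi.2, hj.2]

/-- A noncolliding walk has no multiple points. -/
lemma IsNoncollidingRW.ae_le_one (h : IsNoncollidingRW P' V a P Ξ) (t : ℝ≥0) :
    ∀ᵐ ω ∂P, ∀ x, Ξ t ω x ≤ 1 := by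
  rw [ae_all_iff]
  intro x
  let F : (Fin 1 → Config) → ℝ := fun η => if 2 ≤ η 0 x then 1 else 0
  -- Choosing `T = t` evaluates the determinant at the very time of the collision, so every prelimit
  -- expectation vanishes.
  have hlim := h.representation 1 (fun _ => t) t (Subsingleton.strictMono _) (fun _ => le_rfl) F
    ⟨{x}, fun η η' hη => by simp [F, hη 0 x (Finset.mem_singleton_self x)]⟩
    ⟨1, fun η => by simp only [F]; split_ifs <;> simp⟩
  have hzero : dmrExpectation P' V a (fun _ : Fin 1 => t) t F = fun _ => 0 := by
    funext J
    rw [dmrExpectation]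
    refine integral_eq_zero_of_ae (ae_of_all _ fun ω => ?_)
    by_cases h2 : 2 ≤ empirical J (fun j => V j t ω) x
    · simp [hatD_eq_zero_of_collision J t h2]
    · simp [F, h2]
  rw [hzero] at hlim
  have hint := tendsto_nhds_unique hlim tendsto_const_nhds
  have hmeas : Measurable fun ω => Ξ t ω x := (measurable_pi_apply x).comp (h.measurable t)
  have hFm : Measurable fun ω => F fun _ => Ξ t ω :=
    (measurable_of_countable fun n : ℕ => if 2 ≤ n then (1 : ℝ) else 0).comp hmeas
  have hF0 : ∀ ω, 0 ≤ F fun _ => Ξ t ω := fun ω => by simp only [F]; split_ifs <;> simp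
  have hae := (integral_eq_zero_iff_of_nonneg hF0 (Integrable.of_bound hFm.aestronglyMeasurable 1
    (ae_of_all _ fun ω => by simp only [F]; split_ifs <;> simp))).mp hint
  filter_upwards [hae] with ω hω
  by_contra hlt
  have : 2 ≤ Ξ t ω x := by omega
  simp [F, this] at hω

lemma integrable_prod_points (h : IsNoncollidingRW P' V a P Ξ) {M : ℕ} (t : Fin M → ℝ≥0)
    (A : Fin M → Finset ℤ) : Integrable (fun ω => ∏ m, ∏ x ∈ A m, (Ξ (t m) ω x : ℝ)) P := by
  refine Integrable.of_bound (C := 1) (Measurable.aestronglyMeasurable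
    (Finset.measurable_fun_prod _ fun m _ => Finset.measurable_fun_prod _ fun x _ =>
      (measurable_of_countable fun n : ℕ => (n : ℝ)).comp
        ((measurable_pi_apply x).comp (h.measurable (t m))))) ?_
  filter_upwards [ae_all_iff.mpr fun m => h.ae_le_one (t m)] with ω hω
  rw [Real.norm_eq_abs, Finset.abs_prod]
  refine Finset.prod_le_one (fun _ _ => abs_nonneg _) fun m _ => ?_
  rw [Finset.abs_prod]
  refine Finset.prod_le_one (fun _ _ => abs_nonneg _) fun x _ => ?_
  rw [Nat.abs_cast]
  exact_mod_cast hω m x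

/-- The generating functions of a noncolliding walk expand in its factorial moments. -/
lemma IsNoncollidingRW.hasSum_expansionTerm (h : IsNoncollidingRW P' V a P Ξ) {M : ℕ}
    (t : Fin M → ℝ≥0) (f : Fin M → ℤ →₀ ℝ) :
    Integrable (fun ω => expFunctional f fun m => Ξ (t m) ω) P ∧
    HasSum (expansionTerm f fun A => ((∫ ω, ∏ m, ∏ x ∈ A m, (Ξ (t m) ω x : ℝ) ∂P : ℝ) : ℂ))
      ((∫ ω, expFunctional f (fun m => Ξ (t m) ω) ∂P : ℝ) : ℂ) := by
  have hae : (fun ω => ∑ B : Finset (Fin M × window f),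
      (∏ q : B, (Real.exp (f q.1.1 q.1.2) - 1)) * ∏ m, ∏ x ∈ slices B m, (Ξ (t m) ω x : ℝ)) =ᵐ[P]
      fun ω => expFunctional f fun m => Ξ (t m) ω := by
    filter_upwards [ae_all_iff.mpr fun m => h.ae_le_one (t m)] with ω hω
    rw [expFunctional_eq_sum f hω]
  have hint : ∀ B : Finset (Fin M × window f), Integrable (fun ω =>
      (∏ q : B, (Real.exp (f q.1.1 q.1.2) - 1)) * ∏ m, ∏ x ∈ slices B m, (Ξ (t m) ω x : ℝ)) P :=
    fun B => (integrable_prod_points h t (slices B)).const_mul _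
  refine ⟨(integrable_finsetSum _ fun B _ => hint B).congr hae, ?_⟩
  convert! NoncollidingRW.hasSum_expansionTerm f _ using 1
  rw [← integral_congr_ae hae, integral_finsetSum _ fun B _ => hint B, Complex.ofReal_sum]
  refine Finset.sum_congr rfl fun B _ => ?_
  rw [integral_const_mul, Complex.ofReal_mul, Complex.ofReal_prod]

end

end NoncollidingRW

open NoncollidingRW in
theorem mainTheorem3 (a : ℕ) (ha : 2 ≤ a)
    {Ω' : Type*} [MeasurableSpace Ω'] (P' : Measure Ω') [IsProbabilityMeasure P']
    (V : ℤ → ℝ≥0 → Ω' → ℤ)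
    (hV : ∀ j : ℤ, IsRandomWalk P' (V j) (a * j))
    (hindep : iIndepFun (fun (j : ℤ) (ω : Ω') (t : ℝ≥0) => V j t ω) P') :
    (∀ (M : ℕ) (t : Fin M → ℝ≥0) (T : ℝ≥0), StrictMono t → (∀ m, t m ≤ T) →
      ∀ f : Fin M → ℤ →₀ ℝ, ∃ Ψ : ℝ,
        Tendsto (dmrExpectation P' V a t T (expFunctional f)) atTop (𝓝 Ψ) ∧
        HasSum (expansionTerm f (detKernel (kernel a) t)) (Ψ : ℂ)) ∧
    (∀ {Ω : Type*} [MeasurableSpace Ω] (P : Measure Ω) [IsProbabilityMeasure P]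
      (Ξ : ℝ≥0 → Ω → Config),
      IsNoncollidingRW P' V a P Ξ → IsDeterminantal P Ξ (kernel a)) := by
  have ha0 : a ≠ 0 := by omega
  refine ⟨fun M t T ht hT f => ⟨_, tendsto_dmrExpectation_expFunctional ha0 hV hindep ht hT f,
    hasSum_expansionTerm_kernel a ht f⟩, fun {Ω} _ P _ Ξ hΞ M t ht f => ?_⟩
  have hρ : (fun A => ((∫ ω, ∏ m, ∏ x ∈ A m, (Ξ (t m) ω x : ℝ) ∂P : ℝ) : ℂ)) =
      detKernel (kernel a) t := by
    -- Only nonpositive `g` are tested, since the representation needs a bounded functional.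
    refine eq_of_hasSum_expansionTerm fun g hg => ⟨_, (hΞ.hasSum_expansionTerm t g).2, ?_⟩
    -- Any common upper bound of the times may serve as `T`; the sum also covers `M = 0`.
    have hT : ∀ m, t m ≤ ∑ n, t n := fun m =>
      Finset.single_le_sum (f := t) (fun _ _ => bot_le) (Finset.mem_univ m)
    rw [tendsto_nhds_unique (hΞ.representation M t _ ht hT _ (isLocal_expFunctional g)
      ⟨1, abs_expFunctional_le_one hg⟩)
      (tendsto_dmrExpectation_expFunctional ha0 hV hindep ht hT g)]
    exact hasSum_expansionTerm_kernel a ht g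
  have h := hΞ.hasSum_expansionTerm t f
  rw [hρ] at h
  exact h
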